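/- **Setting.** Let the colors $\{1,\dots,d\}$ be partitioned into slices $D_1,\dots,D_L$ with $\Delta_l=|D_l|\ge 2$ for all $l$ and $\Delta_l\ge 3$ for at least one $l$. A *bubble* is a non-empty connected bipartite graph $B$ with $p$ white and $p$ black vertices whose lines carry colors in $\{1,\dots,d\}$, each vertex carrying exactly one line of each color. Its invariant $B(T,\bar T)$ is the contraction of one tensor $T_{a_1\cdots a_d}$ ($1\le a_c\le N$) per white vertex and one $\bar T$ per black vertex, the indices in position $c$ being contracted along the lines of color $c$; the bubble with two vertices gives $T\cdot\bar T$. Let $B^{(l)}$ be the subgraph of $B$ with all vertices and the lines with colors in $D_l$, and $n(\cdot)$ the number of connected components. Let $\{B_i\}_{i\in I}$ be a finite family of bubbles with $2p_i$ vertices, and $$S=T\cdot\bar T+\sum_{i\in I}t_i\,N^{L-\sum_l n(B_i^{(l)})}\,B_i(T,\bar T),\qquad \langle B\rangle=\frac{\int[dT\,d\bar T]\,B(T,\bar T)\,e^{-N^{d-L}S}}{\int[dT\,d\bar T]\,e^{-N^{d-L}S}},$$ where $\langle B\rangle$ is understood perturbatively, i.e. as a formal power series in the couplings $(t_i)$ (expand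 in the $t_i$ and integrate term by term against $e^{-N^{d-L}T\cdot\bar T}$). Limits of power series are taken coefficientwise. When $\Delta_l\ge 3$, $B^{(l)}$ is called *melonic* if each of its components is reduced to the graph with two vertices by successive removals of elementary melons (two vertices joined by all the lines with colors in $D_l$ but one, replaced by a line of the remaining color); the pairs of vertices removed together, and the last two vertices, are its *canonical pairs*. Call $B$ *relevant* if (i) $B^{(l)}$ is melonic for every $l$ with $\Delta_l\ge3$; (ii) the canonical pairs are the same for all these $l$; (iii) for every $l$ with $\Delta_l=2$, adding to $B^{(l)}$ lines of a color $0$ between the vertices of the canonical pairs (the melonic contraction) gives a 3-colored graph all of whose components are planar, and does not decrease the number of components of $B^{(l)}$. **Statement.** For all $N\ge1$, $$N^d-N^{d-L}\langle T\cdot\bar T\rangle-\sum_{i\in I}t_i\,p_i\,N^{d-\sum_l n(B_i^{(l)})}\langle B_i\rangle=0 .$$ The limit $U=\lim_{N\to\infty}\langle T\cdot\bar T\rangle/N^L$ exists as a formal power series in $(t_i)$, and for every bubble $B$ with $2p$ vertices $$\lim_{N\to\infty}\frac{\langle B\rangle}{N^{\sum_l n(B^{(l)})}}=\begin{cases}U^p&\text{if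 $B$ is relevant},\\ 0&\text{otherwise.}\end{cases}$$ In particular the limit is $0$ if $B^{(l)}$ is not melonic for some $l$ with $\Delta_l\ge3$, if the canonical pairs differ between two slices with at least three colors, or if the melonic contraction is non-planar, or merges components, on a slice with two colors. Moreover $$1-U-\sum_{i\in I,\ B_i\text{ relevant}}t_i\,p_i\,U^{p_i}=0 ;$$ in particular, if all the $B_i$ are relevant, $1-U-\sum_{i\in I}t_i\,p_i\,U^{p_i}=0$, the same equation as for melonic bubbles in the case $L=1$, although the $B_i$ need not be melonic on their $d$ colors. -/

import Mathlib

open Filter Topology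

noncomputable section

/-- A closed bipartite graph with lines colored by `C`, in which every vertex carries exactly one
line of each color.  There are `p` white and `p` black vertices, both labelled by `Fin p`, and the
line of color `c` starting at the white vertex `w` ends at the black vertex `line c w`. -/
structure ColoredGraph (C : Type) where
  /-- half the number of vertices -/
  p : ℕ
  /-- the lines of each color -/
  line : C → Equiv.Perm (Fin p)

namespace ColoredGraph

variable {C : Type}

/-- The subgraph made of all the vertices (white: `Sum.inl`, black: `Sum.inr`) and of the lines
whose color lies in `S`; multiple lines are irrelevant for connectedness. -/
def sub (G : ColoredGraph C) (S : Set C) : SimpleGraph (Fin G.p ⊕ Fin G.p) :=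
  SimpleGraph.fromRel fun x y => ∃ c ∈ S, ∃ w, x = Sum.inl w ∧ y = Sum.inr (G.line c w)

/-- The graph (with all its colors) is connected, in particular it is not empty. -/
def Connected (G : ColoredGraph C) : Prop := (G.sub Set.univ).Connected

/-- The number of connected components of the subgraph with colors in `S`. -/
def numComponents (G : ColoredGraph C) (S : Set C) : ℕ :=
  Nat.card (G.sub S).ConnectedComponent

/-- The number of faces of the subgraph with colors in `S`: a face of colors `c ≠ c'` is a loop with
alternating colors `c` and `c'`, i.e. a connected component of the subgraph with these two colors. -/
def numFaces (G : ColoredGraph C) (S : Finset C) : ℕ :=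
  ∑ e ∈ S.powersetCard 2, G.numComponents (e : Set C)

/-- The genus of the ribbon graph formed by the lines with colors in a set `S` of three colors
(the sum of the genera of its `n` connected components): it has `2 p` vertices, `3 p` lines, and
its Euler characteristic `2 p - 3 p + f` is equal to `2 n - 2 g`. -/
def genus (G : ColoredGraph C) (S : Finset C) : ℚ :=
  (2 * (G.numComponents (S : Set C) : ℚ) + G.p - G.numFaces S) / 2

/-- `IsCanonicalPairing S σ τ`: the graph with lines `σ c`, `c ∈ S`, is reduced by recursive
removals of elementary melons to graphs with two vertices, and `w ↦ τ w` matches the white and the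
black vertex of each canonical pair.

In a removal, the white vertex `w` and the black vertex `τ w` are connected by all the lines with
colors in `S` except possibly the color `c`.  The two external lines of color `c` are cut and
replaced with a single line joining their other ends; the removed pair is kept aside as a separate
closed graph with two vertices.  The process ends when all components have two vertices. -/
inductive IsCanonicalPairing [DecidableEq C] {p : ℕ} (S : Finset C) :
    (C → Equiv.Perm (Fin p)) → Equiv.Perm (Fin p) → Prop
  | two_vertices (σ : C → Equiv.Perm (Fin p)) (τ : Equiv.Perm (Fin p))
      (h : ∀ c ∈ S, σ c = τ) : IsCanonicalPairing S σ τ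
  | remove_melon (σ : C → Equiv.Perm (Fin p)) (τ : Equiv.Perm (Fin p)) (w : Fin p) (c : C)
      (hc : c ∈ S) (hw : ∀ c' ∈ S, c' ≠ c → σ c' w = τ w)
      (h : IsCanonicalPairing S
        (Function.update σ c (Equiv.swap (τ w) (σ c w) * σ c)) τ) :
      IsCanonicalPairing S σ τ

/-- The graph obtained by adding lines of the color `0` (here `none`), which connect the white
vertex `w` to the black vertex `τ w`. -/
def addZero (G : ColoredGraph C) (τ : Equiv.Perm (Fin G.p)) : ColoredGraph (Option C) where
  p := G.p
  line c := c.elim τ G.line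

/-- The bubble with two vertices connected by all the lines; its invariant is `T · T̄`. -/
def dipole (C : Type) : ColoredGraph C where
  p := 1
  line _ := 1

/-- The invariant `G(T, T̄)` of a tensor of size `N × ⋯ × N`: a tensor `T` for each white vertex, a
tensor `T̄` for each black vertex, and the indices in position `c` are contracted along the lines
of color `c`. The index carried by a line is labelled by the white end of the line. -/
def invariant {d : ℕ} (G : ColoredGraph (Fin d)) {N : ℕ} (T : (Fin d → Fin N) → ℂ) : ℂ :=
  ∑ a : Fin G.p → Fin d → Fin N,
    (∏ w, T (a w)) * ∏ b, starRingEnd ℂ (T fun c => a ((G.line c).symm b) c)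

end ColoredGraph

section Slices

variable {d L : ℕ} (s : Fin d → Fin L)

/-- The color slice `D_l`, when the color `c` is put in the slice number `s c`. -/
def slice (l : Fin L) : Finset (Fin d) := Finset.univ.filter fun c => s c = l

/-- The color slice `D_l` together with the color `0`. -/
def slice₀ (l : Fin L) : Finset (Option (Fin d)) := Finset.insertNone (slice s l)

/-- `∑ l, n(G^{(l)})`, the exponent of the scaling of a bubble. -/
def totalComponents (G : ColoredGraph (Fin d)) : ℕ :=
  ∑ l, G.numComponents (slice s l : Set (Fin d))

/-- `τ` matches the vertices of the canonical pairs of `G^{(l)}`. -/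
def IsCanonicalOn (G : ColoredGraph (Fin d)) (l : Fin L) (τ : Equiv.Perm (Fin G.p)) : Prop :=
  ColoredGraph.IsCanonicalPairing (slice s l) G.line τ

/-- `G^{(l)}` is melonic: each of its connected components is obtained from the graph with two
vertices by recursive insertions of elementary melons. -/
def IsMelonicOn (G : ColoredGraph (Fin d)) (l : Fin L) : Prop := ∃ τ, IsCanonicalOn s G l τ

/-- Adding lines of color `0` along `τ` produces a planar graph on the two colors of the slice `l`
and the color `0`. -/
def IsPlanarContraction (G : ColoredGraph (Fin d)) (l : Fin L) (τ : Equiv.Perm (Fin G.p)) : Prop :=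
  (G.addZero τ).genus (slice₀ s l) = 0

/-- Adding lines of color `0` along `τ` does not merge connected components of `G^{(l)}`. -/
def PreservesComponents (G : ColoredGraph (Fin d)) (l : Fin L) (τ : Equiv.Perm (Fin G.p)) : Prop :=
  (G.addZero τ).numComponents (slice₀ s l : Set (Option (Fin d))) =
    G.numComponents (slice s l : Set (Fin d))

/-- The bubble `G` is relevant: it is melonic on each slice with at least three colors, the
canonical pairs are the same for all these slices, and the contraction along the canonical pairs
is planar, without merging of components, on each slice with two colors. -/
def IsRelevant (G : ColoredGraph (Fin d)) : Prop :=
  ∃ τ : Equiv.Perm (Fin G.p),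
    (∀ l, 3 ≤ (slice s l).card → IsCanonicalOn s G l τ) ∧
    (∀ l, (slice s l).card = 2 → IsPlanarContraction s G l τ ∧ PreservesComponents s G l τ)

end Slices

section Model

variable {d L : ℕ} (s : Fin d → Fin L) {ι : Type*} [Fintype ι] (B : ι → ColoredGraph (Fin d))

/-- The perturbative expansion of `∫ [dT dT̄] F(T) exp (- N^{d-L} S(T, T̄))`, with
`S = T · T̄ + ∑ i, t_i N^{L - ∑ l, n(B_i^{(l)})} B_i(T, T̄)`, as a formal power series in the
couplings `t_i`: the exponential of the interaction is expanded in powers of the couplings and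
integrated term by term against the Gaussian weight `exp (- N^{d-L} T · T̄)`. -/
def formalIntegral (N : ℕ) (F : ((Fin d → Fin N) → ℂ) → ℂ) : MvPowerSeries ι ℂ := fun m =>
  ∫ T : (Fin d → Fin N) → ℂ,
    F T *
      (∏ i, (-((N : ℂ) ^ ((d : ℤ) - L) *
          ((N : ℂ) ^ ((L : ℤ) - totalComponents s (B i)) * (B i).invariant T))) ^ m i /
            ((m i).factorial : ℂ)) *
      (Real.exp (-((N : ℝ) ^ ((d : ℤ) - L) * ∑ a, ‖T a‖ ^ 2)) : ℂ)

/-- The expectation value `⟨A(T, T̄)⟩` of a bubble in the model with action `S`, as a formal power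
series in the couplings. The partition function `formalIntegral s B N 1` has a non-zero constant
coefficient and is thus invertible. -/
def expectation (N : ℕ) (A : ColoredGraph (Fin d)) : MvPowerSeries ι ℂ :=
  formalIntegral s B N (fun T => A.invariant T) * (formalIntegral s B N fun _ => 1)⁻¹

/-- `⟨A⟩ / N ^ k` converges to `V` as `N → ∞`, coefficient by coefficient. -/
def HasLeadingOrder (A : ColoredGraph (Fin d)) (k : ℕ) (V : MvPowerSeries ι ℂ) : Prop :=
  ∀ m : ι →₀ ℕ, Tendsto
    (fun N : ℕ => MvPowerSeries.coeff m (expectation s B N A) / (N : ℂ) ^ k) atTop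
    (𝓝 (MvPowerSeries.coeff m V))

end Model

end

/-! All counting is done by linear algebra: a number of components is the dimension `comp` of the
space of locally constant rational functions on the vertices. For a pairing `τ` of the p white with
the p black vertices, the numbers F_c of faces formed by `τ` and a color c of `S` satisfy ∑ F_c + p
≤ |S| p + comp(S) (`sum_faces_le`), and `IsSaturated` is the case of equality. For two colors,
equality means that the contraction is planar and preserves components (`isSaturated_iff_planar`).
For three or more it means that the graph is melonic with canonical pairing `τ`
(`isCanonicalPairing_iff_isSaturated`), which is then unique (`IsSaturated.unique`). A bubble is
therefore relevant exactly when one `τ` is saturated on all slices (`IsGood`).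

Gaussian integration by parts at a white vertex w (`meanSeries_poly`) expresses the expectation of a
graph through its contractions of w with a black vertex b, and through the graphs obtained by gluing
an interaction bubble at w. After rescaling (`scaledCoeff_eq`), a contraction carries a nonpositive
power of N and a gluing carries none. The power is zero exactly for tight contractions, and a good
pairing with τ w = b is the same as a tight contraction together with a good pairing of what remains
(`isGood_contract_iff`). By uniqueness, only one b contributes if the graph is good, and none
otherwise. A glued graph is good if and only if both parts are (`exists_isGood_glue_iff`); the hard
point is that a saturated pairing on three colors cannot straddle the gluing
(`IsSaturated.not_crossing`).

The limits thus obey u_{n+1} = u_n - ∑ t_i p_i u_{n + p_i}, summed over the relevant bubbles. This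
is solved by U^n, where U is the fixed point given by `exists_covariance`. Induction on the degree
in the couplings, then on the number of vertices, concludes (`tendsto_scaledCoeff`). -/

noncomputable section

namespace ColoredGraph

open Module

/-! ### Components as dimensions, and the bound on the number of faces. -/

section Components

variable {W B W' B' : Type*}

/-- The functions on the vertices which are constant along the lines of all the perfect matchings
in `E`. -/
def invSpace (E : Set (W ≃ B)) : Submodule ℚ (W ⊕ B → ℚ) where
  carrier := {f | ∀ e ∈ E, ∀ w, f (Sum.inl w) = f (Sum.inr (e w))}
  add_mem' hf hg e he w := by simp [hf e he w, hg e he w]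
  zero_mem' _ _ _ := rfl
  smul_mem' r f hf e he w := by simp [hf e he w]

/-- The number of connected components of the bipartite graph whose lines are the ones of the
perfect matchings in `E`, as the dimension of the space of locally constant functions. -/
def comp (E : Set (W ≃ B)) : ℕ := finrank ℚ (invSpace E)

lemma invSpace_anti {E E' : Set (W ≃ B)} (h : E ⊆ E') : invSpace E' ≤ invSpace E :=
  fun _ hf e he => hf e (h he)

lemma comp_anti [Finite W] [Finite B] {E E' : Set (W ≃ B)} (h : E ⊆ E') : comp E' ≤ comp E :=
  Submodule.finrank_mono (invSpace_anti h)

/-- Locally constant functions are the functions on the quotient by the relation generated by the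
lines, so their dimension counts the classes. -/
lemma nonempty_linearEquiv_invSpace {E : Set (W ≃ B)} {X : Type*} (q : W ⊕ B → X)
    (hq : ∀ x y, q x = q y ↔ Relation.EqvGen
      (fun x y => ∃ e ∈ E, ∃ w, x = Sum.inl w ∧ y = Sum.inr (e w)) x y)
    (hs : Function.Surjective q) :
    Nonempty ((X → ℚ) ≃ₗ[ℚ] invSpace E) := by
  classical
  have hmem : ∀ g : X → ℚ, g ∘ q ∈ invSpace E := by
    intro g e he w
    exact congrArg g ((hq _ _).2 (.rel _ _ ⟨e, he, w, rfl, rfl⟩))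
  refine ⟨LinearEquiv.ofBijective
    ((LinearMap.funLeft ℚ ℚ q).codRestrict (invSpace E) hmem) ⟨?_, ?_⟩⟩
  · intro g g' h
    have h' : g ∘ q = g' ∘ q := congrArg Subtype.val h
    funext x
    obtain ⟨y, rfl⟩ := hs x
    exact congrFun h' y
  · rintro ⟨f, hf⟩
    have hgen : ∀ x y, q x = q y → f x = f y := by
      intro x y hxy
      rw [hq] at hxy
      induction hxy with
      | rel x y h => obtain ⟨e, he, w, rfl, rfl⟩ := h; exact hf e he w
      | refl => rfl
      | symm _ _ _ ih => exact ih.symm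
      | trans _ _ _ _ _ ih ih' => exact ih.trans ih'
    refine ⟨fun x => f (Function.surjInv hs x), Subtype.ext (funext fun y => ?_)⟩
    exact hgen _ _ (Function.surjInv_eq hs _)

lemma comp_eq_natCard [Finite W] [Finite B] {E : Set (W ≃ B)} {X : Type*} (q : W ⊕ B → X)
    (hq : ∀ x y, q x = q y ↔ Relation.EqvGen
      (fun x y => ∃ e ∈ E, ∃ w, x = Sum.inl w ∧ y = Sum.inr (e w)) x y)
    (hs : Function.Surjective q) : comp E = Nat.card X := by
  have := Finite.of_surjective q hs
  have := Fintype.ofFinite X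
  obtain ⟨L⟩ := nonempty_linearEquiv_invSpace q hq hs
  rw [comp, ← L.finrank_eq, finrank_fintype_fun_eq_card, Nat.card_eq_fintype_card]

/-- The bridge from graph components to dimensions. Unlike `numComponents`, `comp` applies to the
vertex types produced by contractions and gluings. -/
lemma numComponents_eq_comp {C : Type} (G : ColoredGraph C) (S : Set C) :
    G.numComponents S = comp (G.line '' S) := by
  symm
  refine comp_eq_natCard (G.sub S).connectedComponentMk (fun x y => ?_) Quot.mk_surjective
  rw [SimpleGraph.ConnectedComponent.eq]
  constructor
  · rintro ⟨p⟩
    induction p with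
    | nil => exact .refl _
    | cons h _ ih =>
      refine .trans _ _ _ ?_ ih
      rw [sub, SimpleGraph.fromRel_adj] at h
      obtain ⟨-, ⟨c, hc, w, rfl, rfl⟩ | ⟨c, hc, w, rfl, rfl⟩⟩ := h
      · exact .rel _ _ ⟨_, ⟨c, hc, rfl⟩, w, rfl, rfl⟩
      · exact .symm _ _ (.rel _ _ ⟨_, ⟨c, hc, rfl⟩, w, rfl, rfl⟩)
  · intro h
    induction h with
    | rel x y h =>
      obtain ⟨_, ⟨c, hc, rfl⟩, w, rfl, rfl⟩ := h
      refine SimpleGraph.Adj.reachable ?_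
      rw [sub, SimpleGraph.fromRel_adj]
      exact ⟨by simp, .inl ⟨c, hc, w, rfl, rfl⟩⟩
    | refl => rfl
    | symm _ _ _ ih => exact ih.symm
    | trans _ _ _ _ _ ih ih' => exact ih.trans ih'

/-- A function on the white vertices extended along the perfect matching `τ`. -/
def extendAlong (τ : W ≃ B) : (W → ℚ) →ₗ[ℚ] (W ⊕ B → ℚ) where
  toFun f := Sum.elim f (f ∘ τ.symm)
  map_add' f g := by ext (x | x) <;> simp
  map_smul' r f := by ext (x | x) <;> simp

/-- The functions on the white vertices which are constant on the faces formed by `e` and `τ`. -/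
def faceSpace (e τ : W ≃ B) : Submodule ℚ (W → ℚ) where
  carrier := {f | ∀ w, f (e.symm (τ w)) = f w}
  add_mem' hf hg w := by simp [hf w, hg w]
  zero_mem' _ := rfl
  smul_mem' r f hf w := by simp [hf w]

lemma mem_faceSpace {e τ : W ≃ B} {f : W → ℚ} :
    f ∈ faceSpace e τ ↔ ∀ w, f (e.symm (τ w)) = f w := Iff.rfl

/-- The lines of `τ` transport values from white to black vertices, so only the white values are
free; each other color imposes invariance along its faces with `τ`. -/
lemma comp_insert_eq_finrank_iInf [Finite W] {J : Type*} (σ : J → W ≃ B) (τ : W ≃ B) :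
    comp (insert τ (Set.range σ)) = finrank ℚ (⨅ j, faceSpace (σ j) τ : Submodule ℚ (W → ℚ)) := by
  have hmem : ∀ f : W → ℚ, f ∈ (⨅ j, faceSpace (σ j) τ : Submodule ℚ (W → ℚ)) →
      extendAlong τ f ∈ invSpace (insert τ (Set.range σ)) := by
    intro f hf e he w
    simp only [Submodule.mem_iInf, mem_faceSpace] at hf
    rcases he with rfl | ⟨j, rfl⟩
    · simp [extendAlong]
    · have := hf j (τ.symm (σ j w))
      simpa [extendAlong] using this
  symm
  refine LinearEquiv.finrank_eq (LinearEquiv.ofBijective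
    ((extendAlong τ).restrict hmem) ⟨?_, ?_⟩)
  · rintro ⟨f, hf⟩ ⟨g, hg⟩ h
    have h' : extendAlong τ f = extendAlong τ g := congrArg Subtype.val h
    ext w
    exact congrFun h' (Sum.inl w)
  · rintro ⟨f, hf⟩
    refine ⟨⟨fun w => f (Sum.inl w), ?_⟩, Subtype.ext ?_⟩
    · simp only [Submodule.mem_iInf, mem_faceSpace]
      intro j w
      rw [hf (σ j) (.inr ⟨j, rfl⟩), hf τ (.inl rfl)]
      simp
    · ext (w | b)
      · rfl
      · change f (Sum.inl (τ.symm b)) = _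
        rw [hf τ (.inl rfl)]; simp

lemma comp_pair_eq_finrank [Finite W] (e τ : W ≃ B) :
    comp {e, τ} = finrank ℚ (faceSpace e τ) := by
  have := comp_insert_eq_finrank_iInf (fun _ : Unit => e) τ
  rw [Set.range_const, Set.pair_comm, iInf_const] at this
  exact this

lemma comp_singleton [Fintype W] (τ : W ≃ B) : comp {τ} = Fintype.card W := by
  have h := comp_pair_eq_finrank τ τ
  rw [Set.pair_eq_singleton] at h
  have : faceSpace τ τ = ⊤ := by
    ext f; simp [mem_faceSpace]
  rw [h, this, finrank_top, finrank_fintype_fun_eq_card]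

/-- The map whose surjectivity expresses that the faces of the different colors are
independent. -/
def faceMap {J : Type*} (σ : J → W ≃ B) (τ : W ≃ B) :
    (W → ℚ) →ₗ[ℚ] (∀ j, (W → ℚ) ⧸ faceSpace (σ j) τ) :=
  LinearMap.pi fun j => (faceSpace (σ j) τ).mkQ

lemma ker_faceMap {J : Type*} (σ : J → W ≃ B) (τ : W ≃ B) :
    LinearMap.ker (faceMap σ τ) = ⨅ j, faceSpace (σ j) τ := by
  simp [faceMap, LinearMap.ker_pi]

lemma finrank_range_faceMap [Fintype W] {J : Type*} [Fintype J] (σ : J → W ≃ B) (τ : W ≃ B) :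
    finrank ℚ (LinearMap.range (faceMap σ τ)) + comp (insert τ (Set.range σ)) =
      Fintype.card W := by
  rw [comp_insert_eq_finrank_iInf, ← ker_faceMap, LinearMap.finrank_range_add_finrank_ker,
    finrank_fintype_fun_eq_card]

lemma finrank_codomain_faceMap [Fintype W] {J : Type*} [Fintype J] (σ : J → W ≃ B) (τ : W ≃ B) :
    finrank ℚ (∀ j, (W → ℚ) ⧸ faceSpace (σ j) τ) + ∑ j, comp {σ j, τ} =
      Fintype.card J * Fintype.card W := by
  rw [finrank_pi_fintype, ← Finset.sum_add_distrib]
  simp_rw [comp_pair_eq_finrank, Submodule.finrank_quotient_add_finrank]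
  simp

variable {C : Type*}

/-- The range of `faceMap` is at most as large as its codomain. The former has dimension p minus the
components with `τ` added, the latter |S| p minus the number of faces. -/
lemma sum_faces_le_insert [Fintype W] (σ : C → W ≃ B) (τ : W ≃ B) (S : Finset C) :
    ∑ c ∈ S, comp {σ c, τ} + Fintype.card W ≤
      S.card * Fintype.card W + comp (insert τ (σ '' S)) := by
  have h1 := finrank_range_faceMap (fun c : S => σ c) τ
  have h2 := finrank_codomain_faceMap (fun c : S => σ c) τ
  have h3 := Submodule.finrank_le (LinearMap.range (faceMap (fun c : S => σ c) τ))
  have h4 : Set.range (fun c : S => σ c) = σ '' S := by ext; simp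
  rw [h4] at h1
  rw [Finset.sum_coe_sort S (fun c => comp {σ c, τ}), Fintype.card_coe] at h2
  omega

lemma sum_faces_le [Fintype W] [Finite B] (σ : C → W ≃ B) (τ : W ≃ B) (S : Finset C) :
    ∑ c ∈ S, comp {σ c, τ} + Fintype.card W ≤ S.card * Fintype.card W + comp (σ '' S) :=
  (sum_faces_le_insert σ τ S).trans
    (Nat.add_le_add_left (comp_anti (Set.subset_insert _ _)) _)

/-- The pairing `τ` maximizes the number of faces on the colors in `S`. -/
def IsSaturated [Fintype W] (S : Finset C) (σ : C → W ≃ B) (τ : W ≃ B) : Prop :=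
  ∑ c ∈ S, comp {σ c, τ} + Fintype.card W = S.card * Fintype.card W + comp (σ '' S)

lemma IsSaturated.comp_insert [Fintype W] [Finite B] {S : Finset C} {σ : C → W ≃ B} {τ : W ≃ B}
    (h : IsSaturated S σ τ) : comp (insert τ (σ '' S)) = comp (σ '' S) := by
  have h1 := sum_faces_le_insert σ τ S
  have h2 : comp (insert τ (σ '' S)) ≤ comp (σ '' S) := comp_anti (Set.subset_insert _ _)
  unfold IsSaturated at h
  omega

/-- For a saturated pairing, functions can be prescribed independently modulo the functions which
are constant on the faces of each color. -/
lemma IsSaturated.exists_sub_mem [Fintype W] [Finite B] {S : Finset C} {σ : C → W ≃ B}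
    {τ : W ≃ B} (h : IsSaturated S σ τ) (g : C → W → ℚ) :
    ∃ f : W → ℚ, ∀ c ∈ S, f - g c ∈ faceSpace (σ c) τ := by
  have h0 := h.comp_insert
  have h1 := finrank_range_faceMap (fun c : S => σ c) τ
  have h2 := finrank_codomain_faceMap (fun c : S => σ c) τ
  have h4 : Set.range (fun c : S => σ c) = σ '' S := by ext; simp
  rw [h4] at h1
  rw [Finset.sum_coe_sort S (fun c => comp {σ c, τ}), Fintype.card_coe] at h2
  unfold IsSaturated at h
  -- Equality in the bound leaves no room in the codomain, so `faceMap` is onto.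
  have h5 : LinearMap.range (faceMap (fun c : S => σ c) τ) = ⊤ :=
    Submodule.eq_top_of_finrank_eq (by omega)
  obtain ⟨f, hf⟩ := LinearMap.range_eq_top.1 h5 (fun c => Submodule.Quotient.mk (g c))
  refine ⟨f, fun c hc => ?_⟩
  rw [← Submodule.Quotient.eq]
  exact congrFun hf ⟨c, hc⟩

end Components

/-! ### Cutting and contracting a pair of vertices. -/

section Contraction

lemma finrank_eq_add_one_of_inf_ker {M : Type*} [AddCommGroup M] [Module ℚ M]
    [FiniteDimensional ℚ M] {V V' : Submodule ℚ M} (l : M →ₗ[ℚ] ℚ)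
    (h : ∀ v, v ∈ V ↔ v ∈ V' ∧ l v = 0) {v : M} (hv : v ∈ V') (hl : l v ≠ 0) :
    finrank ℚ V' = finrank ℚ V + 1 := by
  have h1 := LinearMap.finrank_range_add_finrank_ker (l.domRestrict V')
  have h2 : LinearMap.range (l.domRestrict V') = ⊤ := by
    rw [LinearMap.range_eq_top]
    intro r
    refine ⟨(r / l v) • ⟨v, hv⟩, ?_⟩
    simp [hl]
  have h3 : V = (LinearMap.ker (l.domRestrict V')).map V'.subtype := by
    ext x
    simp [h, LinearMap.mem_ker, and_comm]
  have h4 : finrank ℚ V = finrank ℚ (LinearMap.ker (l.domRestrict V')) := by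
    rw [h3]
    exact Submodule.finrank_map_subtype_eq V' _
  rw [h2, finrank_top, finrank_self] at h1
  omega

variable {W B W' B' : Type*} [DecidableEq B]

/-- The perfect matching obtained from `e` by cutting the lines at `w` and `b`, joining `w` to `b`
and the two other ends together. -/
def cutPair (w : W) (b : B) (e : W ≃ B) : W ≃ B := e.trans (Equiv.swap b (e w))

@[simp] lemma cutPair_self (w : W) (b : B) (e : W ≃ B) : cutPair w b e w = b := by
  simp [cutPair]

lemma cutPair_apply (w : W) (b : B) (e : W ≃ B) (x : W) :
    cutPair w b e x = Equiv.swap b (e w) (e x) := rfl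

lemma cutPair_eq_self {w : W} {b : B} {e : W ≃ B} (h : e w = b) : cutPair w b e = e := by
  ext x; simp [cutPair, h]

lemma cutPair_ne_iff (w : W) (b : B) (e : W ≃ B) (x : W) : x ≠ w ↔ cutPair w b e x ≠ b := by
  rw [← (cutPair w b e).injective.ne_iff, cutPair_self]

/-- The removal of the vertices `w` and `b`: the two lines at `w` and `b` are joined together (and
the line is deleted if `e` joins `w` and `b`). -/
def contract (w : W) (b : B) (e : W ≃ B) : {x // x ≠ w} ≃ {y // y ≠ b} :=
  (cutPair w b e).subtypeEquiv (cutPair_ne_iff w b e)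

@[simp] lemma contract_apply_coe (w : W) (b : B) (e : W ≃ B) (x : {x // x ≠ w}) :
    (contract w b e x : B) = cutPair w b e x := rfl

/-- All the cut matchings join `w` to `b`, which form a component of their own beside the contracted
graph. For an empty family they would count as two components. -/
lemma comp_cutPair [Finite W] [Finite B] (w : W) (b : B) {E : Set (W ≃ B)} (hE : E.Nonempty) :
    comp (cutPair w b '' E) = comp (contract w b '' E) + 1 := by
  classical
  let res : (W ⊕ B → ℚ) →ₗ[ℚ] ({x // x ≠ w} ⊕ {y // y ≠ b} → ℚ) :=
    LinearMap.funLeft ℚ ℚ (Sum.map Subtype.val Subtype.val)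
  have hmem : ∀ f ∈ invSpace (cutPair w b '' E), res f ∈ invSpace (contract w b '' E) := by
    rintro f hf _ ⟨e, he, rfl⟩ x
    exact hf _ ⟨e, he, rfl⟩ x
  have key := LinearEquiv.finrank_eq (LinearEquiv.ofBijective
    (((LinearMap.proj (R := ℚ) (φ := fun _ : W ⊕ B => ℚ) (Sum.inl w)).domRestrict _).prod
      (res.restrict hmem)) ⟨?_, ?_⟩)
  · rw [comp, key, finrank_prod, finrank_self, add_comm, comp]
  · rintro ⟨f, hf⟩ ⟨g, hg⟩ h
    obtain ⟨e, he⟩ := hE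
    have h1 : f (Sum.inl w) = g (Sum.inl w) := congrArg Prod.fst h
    have h2 : res f = res g := congrArg (fun z => z.2.val) h
    have h3 : f (Sum.inr b) = g (Sum.inr b) := by
      have h3 := hf _ ⟨e, he, rfl⟩ w
      have h4 := hg _ ⟨e, he, rfl⟩ w
      rw [cutPair_self] at h3 h4
      rw [← h3, ← h4, h1]
    ext (x | y)
    · by_cases hx : x = w
      · subst hx; exact h1
      · exact congrFun h2 (Sum.inl ⟨x, hx⟩)
    · by_cases hy : y = b
      · subst hy; exact h3
      · exact congrFun h2 (Sum.inr ⟨y, hy⟩)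
  · rintro ⟨r, ⟨g, hg⟩⟩
    let f : W ⊕ B → ℚ := Sum.elim
      (fun x => if hx : x = w then r else g (Sum.inl ⟨x, hx⟩))
      (fun y => if hy : y = b then r else g (Sum.inr ⟨y, hy⟩))
    have hf : f ∈ invSpace (cutPair w b '' E) := by
      rintro _ ⟨e, he, rfl⟩ x
      by_cases hx : x = w
      · subst hx; simp [f]
      · have hy := (cutPair_ne_iff w b e x).1 hx
        simp only [f, Sum.elim_inl, Sum.elim_inr, hx, hy, dif_neg, not_false_iff]
        exact hg _ ⟨e, he, rfl⟩ ⟨x, hx⟩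
    refine ⟨⟨f, hf⟩, Prod.ext ?_ (Subtype.ext ?_)⟩
    · simp [f]
    · ext (⟨x, hx⟩ | ⟨y, hy⟩)
      · simp [res, f, LinearMap.funLeft, hx]
      · simp [res, f, LinearMap.funLeft, hy]

/-- Identifies a common subspace of the locally constant functions before and after the cut; its
codimension in each gives the change in the number of components. -/
lemma mem_invSpace_cutPair_iff (w : W) (b : B) {E : Set (W ≃ B)} (hE : E.Nonempty)
    (f : W ⊕ B → ℚ) :
    (f ∈ invSpace (cutPair w b '' E) ∧ ∀ e ∈ E, f (Sum.inr b) = f (Sum.inr (e w))) ↔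
      f ∈ invSpace E ∧ f (Sum.inl w) = f (Sum.inr b) := by
  have hswap : ∀ e : W ≃ B, f (Sum.inr b) = f (Sum.inr (e w)) →
      ∀ y, f (Sum.inr (Equiv.swap b (e w) y)) = f (Sum.inr y) := by
    intro e h y
    rcases eq_or_ne y b with rfl | h1
    · rw [Equiv.swap_apply_left, h]
    · rcases eq_or_ne y (e w) with rfl | h2
      · rw [Equiv.swap_apply_right, h]
      · rw [Equiv.swap_apply_of_ne_of_ne h1 h2]
  constructor
  · rintro ⟨hf, h⟩
    refine ⟨fun e he x => ?_, ?_⟩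
    · rw [hf _ ⟨e, he, rfl⟩ x, cutPair_apply, hswap e (h e he)]
    · obtain ⟨e, he⟩ := hE
      rw [hf _ ⟨e, he, rfl⟩ w, cutPair_self]
  · rintro ⟨hf, h⟩
    have h' : ∀ e ∈ E, f (Sum.inr b) = f (Sum.inr (e w)) := fun e he => by
      rw [← hf e he w, h]
    refine ⟨?_, h'⟩
    rintro _ ⟨e, he, rfl⟩ x
    rw [cutPair_apply, hswap e (h' e he), hf e he]

lemma indicator_mem_invSpace_cutPair [DecidableEq W] (w : W) (b : B) (E : Set (W ≃ B)) :
    (Sum.elim (fun x => if x = w then 1 else 0) (fun y => if y = b then 1 else 0) : W ⊕ B → ℚ) ∈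
      invSpace (cutPair w b '' E) := by
  rintro _ ⟨e, he, rfl⟩ x
  by_cases hx : x = w
  · subst hx; simp
  · simp [hx, (cutPair_ne_iff w b e x).1 hx]

/-- Contracting a pair of vertices connected by all the lines but one does not change the number
of components. -/
lemma comp_contract_of_melon [Finite W] [Finite B] {w : W} {b : B} {E : Set (W ≃ B)}
    {e₀ e₁ : W ≃ B} (h₀ : e₀ ∈ E) (h₁ : e₁ ∈ E) (hw₀ : e₀ w ≠ b) (hw₁ : e₁ w = b)
    (hE : ∀ e ∈ E, e ≠ e₀ → e w = b) : comp (contract w b '' E) = comp E := by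
  classical
  -- Since `e₁` joins `w` to `b`, the common subspace is all of `invSpace E`. Only `e₀` imposes a
  -- condition, violated by the indicator of the pair.
  have h := finrank_eq_add_one_of_inf_ker (V := invSpace E) (V' := invSpace (cutPair w b '' E))
    (LinearMap.proj (R := ℚ) (φ := fun _ : W ⊕ B => ℚ) (Sum.inr b) - LinearMap.proj (Sum.inr (e₀ w)))
    (fun f => ?_) (indicator_mem_invSpace_cutPair w b E) (by simp [hw₀])
  · have := comp_cutPair w b ⟨e₀, h₀⟩
    unfold comp at *
    omega
  · have hb : f ∈ invSpace E → f (Sum.inl w) = f (Sum.inr b) := fun hf => by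
      rw [hf e₁ h₁, hw₁]
    have h2 := mem_invSpace_cutPair_iff w b ⟨e₀, h₀⟩ f
    have h3 : (∀ e ∈ E, f (Sum.inr b) = f (Sum.inr (e w))) ↔
        f (Sum.inr b) = f (Sum.inr (e₀ w)) := by
      refine ⟨fun h => h e₀ h₀, fun h e he => ?_⟩
      by_cases hee : e = e₀
      · rw [hee, h]
      · rw [hE e he hee]
    rw [h3] at h2
    simp only [LinearMap.sub_apply, LinearMap.proj_apply, sub_eq_zero]
    rw [h2]
    tauto

/-- Contracting a pair of `τ` shortens the face through it, except that a face of length one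
disappears. -/
lemma comp_pair_contract [Finite W] [Finite B] {w : W} {b : B} (e τ : W ≃ B) (h : τ w = b) :
    comp {e, τ} = (if e w = b then 1 else 0) + comp {contract w b e, contract w b τ} := by
  split_ifs with he
  · have := comp_cutPair w b (E := {e, τ}) ⟨e, by simp⟩
    rw [Set.image_pair, Set.image_pair, cutPair_eq_self he, cutPair_eq_self h] at this
    omega
  · have := comp_contract_of_melon (E := {e, τ}) (e₀ := e) (e₁ := τ) (w := w) (b := b)
      (by simp) (by simp) he h (by rintro x (rfl | rfl) hx <;> simp_all)
    rw [Set.image_pair] at this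
    omega

/-- The number of faces created by a contraction, and the number of components afterwards. -/
lemma card_add_comp_contract_le [Finite W] [Finite B] {C : Type*} (w : W) (b : B)
    (σ : C → W ≃ B) {S : Finset C} (hS : S.Nonempty) :
    (S.filter fun c => σ c w = b).card + comp ((fun c => contract w b (σ c)) '' S) + 1 ≤
      S.card + comp (σ '' S) := by
  obtain ⟨c₀, hc₀⟩ := hS
  have hE : (σ '' S).Nonempty := ⟨_, c₀, hc₀, rfl⟩
  have h1 := comp_cutPair w b hE
  rw [← Set.image_comp (contract w b)] at h1
  set T := S.filter fun c => ¬ σ c w = b with hT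
  -- One linear condition for each color whose line at `w` misses `b`; together they bring the
  -- functions of the cut graph back to functions of the original one.
  let l : (W ⊕ B → ℚ) →ₗ[ℚ] (T → ℚ) := LinearMap.pi fun c =>
    LinearMap.proj (R := ℚ) (φ := fun _ : W ⊕ B => ℚ) (Sum.inr b) -
      LinearMap.proj (Sum.inr (σ c w))
  have h2 := LinearMap.finrank_range_add_finrank_ker (l.domRestrict (invSpace (cutPair w b '' (σ '' S))))
  have h3 : finrank ℚ (LinearMap.range (l.domRestrict (invSpace (cutPair w b '' (σ '' S))))) ≤
      T.card := by
    refine (Submodule.finrank_le _).trans ?_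
    simp
  have h4 : (LinearMap.ker (l.domRestrict (invSpace (cutPair w b '' (σ '' S))))).map
      (Submodule.subtype _) ≤ invSpace (σ '' S) := by
    rintro _ ⟨⟨f, hf⟩, hl, rfl⟩
    refine ((mem_invSpace_cutPair_iff w b hE f).1 ⟨hf, ?_⟩).1
    rintro _ ⟨c, hc, rfl⟩
    by_cases hcw : σ c w = b
    · rw [hcw]
    · have := congrFun hl ⟨c, by simp [T, hcw, Finset.mem_coe.1 hc]⟩
      simpa [l, sub_eq_zero] using this
  have h5 := Submodule.finrank_mono h4
  rw [Submodule.finrank_map_subtype_eq] at h5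
  have h6 : (S.filter fun c => σ c w = b).card + T.card = S.card := by
    convert Finset.card_filter_add_card_filter_not (s := S) (fun c => σ c w = b)
  change comp (cutPair w b '' (σ '' S)) = comp ((fun c => contract w b (σ c)) '' S) + 1 at h1
  change _ + _ = comp (cutPair w b '' (σ '' S)) at h2
  change _ ≤ comp (σ '' S) at h5
  omega

end Contraction

/-! ### Components of disjoint unions and of glued graphs. -/

section Gluing

variable {W B W' B' : Type*} {C : Type*}

/-- The disjoint union of two graphs. -/
def union (σ : C → W ≃ B) (σ' : C → W' ≃ B') (c : C) : W ⊕ W' ≃ B ⊕ B' :=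
  (σ c).sumCongr (σ' c)

lemma comp_union [Finite W] [Finite B] [Finite W'] [Finite B'] (σ : C → W ≃ B)
    (σ' : C → W' ≃ B') (S : Set C) :
    comp (union σ σ' '' S) = comp (σ '' S) + comp (σ' '' S) := by
  let r₁ : ((W ⊕ W') ⊕ (B ⊕ B') → ℚ) →ₗ[ℚ] (W ⊕ B → ℚ) :=
    LinearMap.funLeft ℚ ℚ (Sum.map Sum.inl Sum.inl)
  let r₂ : ((W ⊕ W') ⊕ (B ⊕ B') → ℚ) →ₗ[ℚ] (W' ⊕ B' → ℚ) :=
    LinearMap.funLeft ℚ ℚ (Sum.map Sum.inr Sum.inr)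
  have h₁ : ∀ f ∈ invSpace (union σ σ' '' S), r₁ f ∈ invSpace (σ '' S) := by
    rintro f hf _ ⟨c, hc, rfl⟩ x
    exact hf _ ⟨c, hc, rfl⟩ (Sum.inl x)
  have h₂ : ∀ f ∈ invSpace (union σ σ' '' S), r₂ f ∈ invSpace (σ' '' S) := by
    rintro f hf _ ⟨c, hc, rfl⟩ x
    exact hf _ ⟨c, hc, rfl⟩ (Sum.inr x)
  have key := LinearEquiv.finrank_eq (LinearEquiv.ofBijective
    ((r₁.restrict h₁).prod (r₂.restrict h₂)) ⟨?_, ?_⟩)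
  · rw [comp, key, finrank_prod]; rfl
  · rintro ⟨f, hf⟩ ⟨g, hg⟩ h
    have e₁ : r₁ f = r₁ g := congrArg (fun z => z.1.val) h
    have e₂ : r₂ f = r₂ g := congrArg (fun z => z.2.val) h
    ext ((x | x) | (x | x))
    · exact congrFun e₁ (Sum.inl x)
    · exact congrFun e₂ (Sum.inl x)
    · exact congrFun e₁ (Sum.inr x)
    · exact congrFun e₂ (Sum.inr x)
  · rintro ⟨⟨f, hf⟩, ⟨g, hg⟩⟩
    refine ⟨⟨Sum.elim (Sum.elim (fun x => f (Sum.inl x)) (fun x => g (Sum.inl x)))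
      (Sum.elim (fun x => f (Sum.inr x)) (fun x => g (Sum.inr x))), ?_⟩,
      Prod.ext (Subtype.ext ?_) (Subtype.ext ?_)⟩
    · rintro _ ⟨c, hc, rfl⟩ (x | x)
      · exact hf _ ⟨c, hc, rfl⟩ x
      · exact hg _ ⟨c, hc, rfl⟩ x
    · ext (x | x) <;> rfl
    · ext (x | x) <;> rfl

variable [DecidableEq B] [DecidableEq B']

/-- Contracting a white vertex of a graph with a black vertex of another graph merges two
components. -/
lemma comp_contract_union [Fintype W] [Fintype B] [Finite W'] [Finite B'] (σ : C → W ≃ B)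
    (σ' : C → W' ≃ B') (w : W) (b : B') {S : Set C} (hS : S.Nonempty) :
    comp ((fun c => contract (Sum.inl w) (Sum.inr b) (union σ σ' c)) '' S) + 1 =
      comp (σ '' S) + comp (σ' '' S) := by
  classical
  have hE : (union σ σ' '' S).Nonempty := hS.image _
  have h1 := comp_cutPair (Sum.inl w) (Sum.inr b) hE
  rw [← Set.image_comp (contract _ _)] at h1
  change _ = comp ((fun c => contract (Sum.inl w) (Sum.inr b) (union σ σ' c)) '' S) + 1 at h1
  rw [← h1, ← comp_union]
  obtain ⟨c₀, hc₀⟩ := hS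
  let lV : ((W ⊕ W') ⊕ (B ⊕ B') → ℚ) →ₗ[ℚ] ℚ :=
    LinearMap.proj (R := ℚ) (φ := fun _ => ℚ) (Sum.inl (Sum.inl w)) -
      LinearMap.proj (Sum.inr (Sum.inr b))
  let lV' : ((W ⊕ W') ⊕ (B ⊕ B') → ℚ) →ₗ[ℚ] ℚ :=
    LinearMap.proj (R := ℚ) (φ := fun _ => ℚ) (Sum.inr (Sum.inr b)) -
      LinearMap.proj (Sum.inr (Sum.inl (σ c₀ w)))
  -- A hyperplane both among the functions of the disjoint union and among those of the cut graph,
  -- whose dimensions therefore agree.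
  let V₀ := invSpace (union σ σ' '' S) ⊓ LinearMap.ker lV
  have e1 := finrank_eq_add_one_of_inf_ker (V := V₀) (V' := invSpace (union σ σ' '' S)) lV
    (fun v => by simp [V₀, LinearMap.mem_ker])
    (v := Sum.elim (Sum.elim 0 1) (Sum.elim 0 1))
    (by rintro _ ⟨c, hc, rfl⟩ (x | x) <;> simp [union]) (by simp [lV])
  have e2 := finrank_eq_add_one_of_inf_ker (V := V₀)
    (V' := invSpace (cutPair (Sum.inl w) (Sum.inr b) '' (union σ σ' '' S))) lV'
    (fun f => ?_) (indicator_mem_invSpace_cutPair _ _ _) (by simp [lV'])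
  · unfold comp
    rw [e1, e2]
  · have h2 := mem_invSpace_cutPair_iff (Sum.inl w) (Sum.inr b) hE f
    have h3 : f ∈ V₀ ↔ f ∈ invSpace (union σ σ' '' S) ∧
        f (Sum.inl (Sum.inl w)) = f (Sum.inr (Sum.inr b)) := by
      simp [V₀, lV, sub_eq_zero]
    rw [h3, ← h2]
    refine and_congr_right fun hf => ?_
    simp only [lV', LinearMap.sub_apply, LinearMap.proj_apply, sub_eq_zero]
    refine ⟨fun h => h _ ⟨c₀, hc₀, rfl⟩, fun h => ?_⟩
    -- In the first graph only the line at `w` is cut, so subtracting the white values from the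
    -- black ones isolates the value at its end. The result does not depend on the color, hence the
    -- condition for `c₀` implies all the others.
    have hsum : ∀ c ∈ S, f (Sum.inr (Sum.inl (σ c w))) = ∑ y, f (Sum.inr (Sum.inl y)) -
        ∑ x ∈ Finset.univ.erase w, f (Sum.inl (Sum.inl x)) := by
      intro c hc
      rw [← (σ c).sum_comp, ← Finset.add_sum_erase _ _ (Finset.mem_univ w)]
      have : ∀ x ∈ Finset.univ.erase w,
          f (Sum.inl (Sum.inl x)) = f (Sum.inr (Sum.inl (σ c x))) := by
        intro x hx
        have hx' : σ c x ≠ σ c w := (σ c).injective.ne (Finset.ne_of_mem_erase hx)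
        rw [hf _ ⟨_, ⟨c, hc, rfl⟩, rfl⟩ (Sum.inl x), cutPair_apply]
        simp only [union, Equiv.sumCongr_apply, Sum.map_inl]
        rw [Equiv.swap_apply_of_ne_of_ne (by simp) (by simpa using hx')]
      rw [Finset.sum_congr rfl this]
      ring
    rintro _ ⟨c, hc, rfl⟩
    simp only [union, Equiv.sumCongr_apply, Sum.map_inl]
    rw [h, hsum c hc, hsum c₀ hc₀]

end Gluing

/-! ### Saturated pairings: existence of melons and uniqueness. -/

section Saturated

variable {W B W' B' : Type*} {C : Type*}

lemma comp_pair_le [Fintype W] [Finite B] (e τ : W ≃ B) : comp {e, τ} ≤ Fintype.card W := by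
  rw [← comp_singleton τ]
  exact comp_anti (by simp)

lemma isSaturated_of_forall_eq [Fintype W] {S : Finset C} (hS : S.Nonempty) {σ : C → W ≃ B}
    {τ : W ≃ B} (h : ∀ c ∈ S, σ c = τ) : IsSaturated S σ τ := by
  have h1 : σ '' S = {τ} := by
    ext e
    simp only [Set.mem_image, Finset.mem_coe, Set.mem_singleton_iff]
    constructor
    · rintro ⟨c, hc, rfl⟩; exact h c hc
    · rintro rfl; obtain ⟨c, hc⟩ := hS; exact ⟨c, hc, h c hc⟩
  have h2 : ∑ c ∈ S, comp {σ c, τ} = S.card * Fintype.card W := by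
    rw [Finset.sum_const_nat (m := Fintype.card W)]
    intro c hc
    rw [h c hc, Set.pair_eq_singleton, comp_singleton]
  rw [IsSaturated, h1, h2, comp_singleton]

lemma update_cutPair_eq [DecidableEq B] [DecidableEq C] {S : Finset C} {σ : C → W ≃ B}
    {w : W} {b : B} {c : C} (hw : ∀ c' ∈ S, c' ≠ c → σ c' w = b) {c' : C} (hc' : c' ∈ S) :
    Function.update σ c (cutPair w b (σ c)) c' = cutPair w b (σ c') := by
  by_cases h : c' = c
  · subst h; simp
  · rw [Function.update_of_ne h, cutPair_eq_self (hw c' hc' h)]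

lemma exists_mem_ne_of_two_le_card {S : Finset C} (hS : 2 ≤ S.card) (c : C) :
    ∃ c' ∈ S, c' ≠ c := Finset.exists_mem_ne (by omega) c

/-- The removal of an elementary melon creates one face and one component. -/
lemma melon_removal_counts [DecidableEq B] [DecidableEq C] [Fintype W] [Finite B] {S : Finset C}
    (hS : 2 ≤ S.card) {σ : C → W ≃ B} {τ : W ≃ B} {w : W} {c : C} (hc : c ∈ S)
    (hw : ∀ c' ∈ S, c' ≠ c → σ c' w = τ w) (hcw : σ c w ≠ τ w) :
    ∑ c' ∈ S, comp {Function.update σ c (cutPair w (τ w) (σ c)) c', τ} =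
      ∑ c' ∈ S, comp {σ c', τ} + 1 ∧
    comp (Function.update σ c (cutPair w (τ w) (σ c)) '' S) = comp (σ '' S) + 1 := by
  obtain ⟨c₁, hc₁, hne⟩ := exists_mem_ne_of_two_le_card hS c
  constructor
  · rw [← Finset.add_sum_erase _ _ hc, ← Finset.add_sum_erase S (fun c' => comp {σ c', τ}) hc]
    have h1 : comp {cutPair w (τ w) (σ c), τ} = comp {σ c, τ} + 1 := by
      have h := comp_pair_contract (σ c) τ (w := w) rfl
      have h' := comp_cutPair w (τ w) (E := {σ c, τ}) ⟨_, Set.mem_insert _ _⟩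
      rw [Set.image_pair, Set.image_pair, cutPair_eq_self rfl] at h'
      rw [if_neg hcw] at h
      omega
    rw [Function.update_self, h1, Finset.sum_congr rfl (fun c' hc' => by
      rw [Function.update_of_ne (Finset.ne_of_mem_erase hc')])]
    ring
  · have h1 : Function.update σ c (cutPair w (τ w) (σ c)) '' S =
        cutPair w (τ w) '' (σ '' S) := by
      rw [Set.image_image]
      exact Set.image_congr fun c' hc' => update_cutPair_eq hw hc'
    rw [h1, comp_cutPair _ _ (Set.Nonempty.image σ ⟨c, hc⟩),
      comp_contract_of_melon (Set.mem_image_of_mem σ hc) (Set.mem_image_of_mem σ hc₁) hcw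
        (hw c₁ hc₁ hne)]
    rintro _ ⟨c', hc', rfl⟩ h
    exact hw c' hc' fun h' => h (by rw [h'])

/-- A proper removal adds one to both sides of the equality; if `c` also joins the pair, nothing
changes. -/
lemma isSaturated_update_iff [DecidableEq B] [DecidableEq C] [Fintype W] [Finite B]
    {S : Finset C} (hS : 2 ≤ S.card) {σ : C → W ≃ B} {τ : W ≃ B} {w : W} {c : C} (hc : c ∈ S)
    (hw : ∀ c' ∈ S, c' ≠ c → σ c' w = τ w) :
    IsSaturated S (Function.update σ c (cutPair w (τ w) (σ c))) τ ↔ IsSaturated S σ τ := by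
  by_cases hcw : σ c w = τ w
  · rw [cutPair_eq_self hcw, Function.update_eq_self]
  · obtain ⟨h1, h2⟩ := melon_removal_counts hS hc hw hcw
    rw [IsSaturated, IsSaturated, h1, h2]
    omega

/-- Two vertices with at least two lines in common are paired by every saturated pairing. -/
lemma IsSaturated.apply_eq_of_two_lines [Fintype W] [Finite B] {S : Finset C} {σ : C → W ≃ B}
    {τ : W ≃ B} (h : IsSaturated S σ τ) {c₁ c₂ : C} (h₁ : c₁ ∈ S) (h₂ : c₂ ∈ S) (hne : c₁ ≠ c₂)
    {w : W} (hw : σ c₁ w = σ c₂ w) : τ w = σ c₁ w := by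
  classical
  by_contra hτ
  set x := τ.symm (σ c₁ w) with hx
  have hxw : x ≠ w := fun h => hτ (by
    rw [← Equiv.eq_symm_apply, ← hx, h])
  -- Prescribe 1 at `w` in color `c₁` and 0 otherwise. As `x` and `w` share a face in both colors,
  -- `f w - f x` would be 1 by `c₁` and 0 by `c₂`.
  obtain ⟨f, hf⟩ := h.exists_sub_mem fun c => if c = c₁ then Pi.single w 1 else 0
  have e₁ := mem_faceSpace.1 (hf c₁ h₁) x
  have e₂ := mem_faceSpace.1 (hf c₂ h₂) x
  have s₁ : (σ c₁).symm (τ x) = w := by simp [hx]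
  have s₂ : (σ c₂).symm (τ x) = w := by simp [hx, hw]
  rw [s₁] at e₁
  rw [s₂] at e₂
  simp [hne.symm] at e₂
  simp [hxw, e₂] at e₁

/-- A pairing with `q` faces has at least `2 q - p` faces of length one. -/
lemma two_mul_comp_pair_le [Fintype W] [DecidableEq B] (e τ : W ≃ B) :
    2 * comp {e, τ} ≤ Fintype.card W + (Finset.univ.filter fun w => e w = τ w).card := by
  classical
  let π : Equiv.Perm W := τ.trans e.symm
  let X := Quotient (Equiv.Perm.SameCycle.setoid π)
  let q : W → X := Quotient.mk _
  have hconst : ∀ f ∈ faceSpace e τ, ∀ x y, q x = q y → f x = f y := by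
    intro f hf x y hxy
    obtain ⟨n, rfl⟩ : π.SameCycle x y := Quotient.exact hxy
    have hstep : ∀ z, f (π z) = f z := hf
    have hnat : ∀ (n : ℕ) (z : W), f ((π ^ n) z) = f z := by
      intro n
      induction n with
      | zero => simp
      | succ n ih => intro z; rw [pow_succ, Equiv.Perm.mul_apply, ih, hstep]
    obtain ⟨n, rfl | rfl⟩ := n.eq_nat_or_neg
    · rw [zpow_natCast, hnat]
    · rw [← hnat n ((π ^ (-(n : ℤ))) x), ← Equiv.Perm.mul_apply,
        ← zpow_natCast, ← zpow_add, add_neg_cancel, zpow_zero, Equiv.Perm.one_apply]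
  have h1 : comp {e, τ} ≤ Fintype.card X := by
    rw [comp_pair_eq_finrank, ← finrank_fintype_fun_eq_card (R := ℚ)]
    refine LinearMap.finrank_le_finrank_of_injective
      (f := (LinearMap.funLeft ℚ ℚ (Quotient.out : X → W)).domRestrict (faceSpace e τ)) ?_
    rintro ⟨f, hf⟩ ⟨g, hg⟩ h
    ext x
    have := congrFun h (q x)
    change f (q x).out = g (q x).out at this
    change f x = g x
    rw [hconst f hf x (q x).out (Quotient.out_eq _).symm, this,
      hconst g hg x (q x).out (Quotient.out_eq _).symm]
  refine (Nat.mul_le_mul_left 2 h1).trans ?_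
  rw [← Finset.card_univ (α := W), ← Finset.card_univ (α := X),
    Finset.card_eq_sum_card_fiberwise (f := q) (s := Finset.univ) (t := Finset.univ) (by simp),
    Finset.card_eq_sum_card_fiberwise (f := q) (t := Finset.univ)
      (s := Finset.univ.filter fun w => e w = τ w) (by simp),
    ← Finset.sum_add_distrib, mul_comm, ← smul_eq_mul]
  -- Each cycle of `π` is worth at least 2: it has two elements, or it is a fixed point, counted
  -- once in each sum.
  refine Finset.card_nsmul_le_sum _ _ _ fun x _ => ?_
  obtain ⟨w, rfl⟩ := Quotient.exists_rep x
  have hw : w ∈ Finset.univ.filter fun a => q a = q w := by simp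
  have hπw : π w ∈ Finset.univ.filter fun a => q a = q w := by
    simp only [Finset.mem_filter, Finset.mem_univ, true_and]
    exact Quotient.sound (Equiv.Perm.SameCycle.refl π w |>.apply_left)
  change 2 ≤ (Finset.univ.filter fun a => q a = q w).card +
    ((Finset.univ.filter fun a => e a = τ a).filter fun a => q a = q w).card
  by_cases hfix : e w = τ w
  · have a1 := Finset.card_pos.2 ⟨w, hw⟩
    have a2 := Finset.card_pos.2 (⟨w, by simp [hfix]⟩ :
      ((Finset.univ.filter fun a => e a = τ a).filter fun a => q a = q w).Nonempty)
    omega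
  · have hne : w ≠ π w := fun h => hfix (by
      conv_lhs => rw [h]
      simp [π])
    have := Finset.one_lt_card.2 ⟨w, hw, π w, hπw, hne⟩
    omega

/-- The number of components is larger than the number of components with two vertices, if there
is another vertex. -/
lemma card_lt_comp_of_exists [Fintype W] [Finite B] {S : Set C} {σ : C → W ≃ B} {τ : W ≃ B}
    (P : W → Prop) [DecidablePred P] (hP : ∀ w, P w ↔ ∀ c ∈ S, σ c w = τ w) {w₀ : W}
    (hw₀ : ¬ P w₀) : (Finset.univ.filter P).card < comp (σ '' S) := by
  -- Everything outside the two-vertex components is sent to `none`, which gives at least one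
  -- further component because of `w₀`.
  let φ : W → Option {w // P w} := fun w => if h : P w then some ⟨w, h⟩ else none
  have hφ : Function.Surjective φ := by
    rintro (_ | ⟨w, hw⟩)
    · exact ⟨w₀, by simp [φ, hw₀]⟩
    · exact ⟨w, by simp [φ, hw]⟩
  let m : (Option {w // P w} → ℚ) →ₗ[ℚ] (W ⊕ B → ℚ) :=
    LinearMap.funLeft ℚ ℚ (Sum.elim φ (φ ∘ τ.symm))
  have hm : ∀ g, m g ∈ invSpace (σ '' S) := by
    rintro g _ ⟨c, hc, rfl⟩ w
    refine congrArg g ?_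
    simp only [Sum.elim_inl, Sum.elim_inr, Function.comp_apply]
    by_cases h : P w
    · rw [(hP w).1 h c hc, Equiv.symm_apply_apply]
    · have h' : ¬ P (τ.symm (σ c w)) := by
        intro h'
        have := (hP _).1 h' c hc
        rw [Equiv.apply_symm_apply] at this
        exact h ((σ c).injective this ▸ h')
      simp [φ, h, h']
  have h1 := LinearMap.finrank_le_finrank_of_injective (f := m.codRestrict _ hm) (by
    intro g g' h
    have h' : m g = m g' := congrArg Subtype.val h
    funext x
    obtain ⟨w, rfl⟩ := hφ x
    exact congrFun h' (Sum.inl w))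
  rw [finrank_fintype_fun_eq_card, Fintype.card_option, Fintype.card_subtype] at h1
  exact h1

/-- In a graph with a saturated pairing, either all components have two vertices, or there is an
elementary melon. -/
lemma IsSaturated.exists_melon [Fintype W] [Finite B] {S : Finset C} {σ : C → W ≃ B} {τ : W ≃ B}
    (h : IsSaturated S σ τ) (hne : ∃ c ∈ S, σ c ≠ τ) :
    ∃ w, ∃ c ∈ S, σ c w ≠ τ w ∧ ∀ c' ∈ S, c' ≠ c → σ c' w = τ w := by
  classical
  by_contra hcon
  push Not at hcon
  obtain ⟨P, hP⟩ : ∃ P : W → Prop, ∀ w, P w ↔ ∀ c ∈ S, σ c w = τ w := ⟨_, fun _ => Iff.rfl⟩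
  obtain ⟨c₀, hc₀, hc₀'⟩ := hne
  obtain ⟨w₀, hw₀⟩ : ∃ w, σ c₀ w ≠ τ w := by
    by_contra! h'
    exact hc₀' (Equiv.ext h')
  have hw₀P : ¬ P w₀ := fun h' => hw₀ ((hP w₀).1 h' c₀ hc₀)
  have hP' : ∀ w, P w ↔ ∀ c ∈ (S : Set C), σ c w = τ w := fun w => by
    simp only [hP, Finset.mem_coe]
  have h1 := card_lt_comp_of_exists P hP' hw₀P
  have h2 : ∑ c ∈ S, 2 * comp {σ c, τ} ≤ S.card * Fintype.card W +
      ∑ c ∈ S, (Finset.univ.filter fun w => σ c w = τ w).card := by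
    refine (Finset.sum_le_sum fun c _ => two_mul_comp_pair_le (σ c) τ).trans ?_
    rw [Finset.sum_add_distrib, Finset.sum_const, smul_eq_mul]
  have h3 : ∑ c ∈ S, (Finset.univ.filter fun w => σ c w = τ w).card =
      ∑ w, (S.filter fun c => σ c w = τ w).card := by
    simp_rw [Finset.card_filter]
    exact Finset.sum_comm
  -- Without a melon, a vertex outside the two-vertex components misses its partner in at least two
  -- colors. Summed and combined with `h2`, this leaves no more components than those with two
  -- vertices, against `h1`.
  have h4 : ∀ w, (S.filter fun c => σ c w = τ w).card + 2 ≤ S.card + if P w then 2 else 0 := by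
    intro w
    split_ifs with hw
    · have := Finset.card_filter_le S (fun c => σ c w = τ w); omega
    · simp only [hP, not_forall] at hw
      obtain ⟨c₁, hc₁, hcw₁⟩ := hw
      obtain ⟨c₂, hc₂, h12, hcw₂⟩ := hcon w c₁ hc₁ hcw₁
      have hsub : (S.filter fun c => σ c w = τ w) ⊆ (S.erase c₁).erase c₂ := by
        intro c hc
        simp only [Finset.mem_filter] at hc
        simp only [Finset.mem_erase]
        refine ⟨?_, ?_, hc.1⟩
        · rintro rfl; exact hcw₂ hc.2
        · rintro rfl; exact hcw₁ hc.2
      have a1 := Finset.card_le_card hsub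
      have a2 := Finset.card_erase_add_one hc₁
      have a3 := Finset.card_erase_add_one (Finset.mem_erase.2 ⟨h12, hc₂⟩)
      omega
  have h5 := Finset.sum_le_sum fun w (_ : w ∈ Finset.univ) => h4 w
  rw [Finset.sum_add_distrib, Finset.sum_add_distrib, ← h3, ← Finset.sum_filter] at h5
  simp only [Finset.sum_const, smul_eq_mul, Finset.card_univ] at h5
  rw [← Finset.mul_sum] at h2
  unfold IsSaturated at h
  rw [mul_comm (Fintype.card W) S.card] at h5
  have h6 : comp (σ '' S) ≤ (Finset.univ.filter fun w => P w).card := by omega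
  refine absurd h1 (not_lt.2 (h6.trans (le_of_eq ?_)))
  congr!

/-- Saturated pairings are unique if there are at least three colors. -/
lemma IsSaturated.unique [Fintype W] [Finite B] {S : Finset C} (hS : 3 ≤ S.card)
    {τ τ' : W ≃ B} (n : ℕ) :
    ∀ {σ : C → W ≃ B}, S.card * Fintype.card W ≤ ∑ c ∈ S, comp {σ c, τ} + n →
      IsSaturated S σ τ → IsSaturated S σ τ' → τ' = τ := by
  classical
  -- Besides `c` at least two colors remain, and two common lines force the partner; this is why
  -- three colors are needed.
  have key : ∀ (σ : C → W ≃ B) (c : C) (w : W), IsSaturated S σ τ' →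
      (∀ c' ∈ S, c' ≠ c → σ c' w = τ w) → τ' w = τ w := by
    intro σ c w h' hw
    have h2 : 1 < (S.erase c).card := by
      have := Finset.pred_card_le_card_erase (s := S) (a := c); omega
    obtain ⟨c₁, h₁, c₂, h₂, h12⟩ := Finset.one_lt_card.1 h2
    rw [Finset.mem_erase] at h₁ h₂
    have e₁ := hw c₁ h₁.2 h₁.1
    have e₂ := hw c₂ h₂.2 h₂.1
    rw [h'.apply_eq_of_two_lines h₁.2 h₂.2 h12 (e₁.trans e₂.symm), e₁]
  have hbase : ∀ σ : C → W ≃ B, IsSaturated S σ τ' → (∀ c ∈ S, σ c = τ) → τ' = τ := by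
    intro σ h' hne
    obtain ⟨c, hc⟩ := Finset.card_pos.1 (by omega : 0 < S.card)
    exact Equiv.ext fun w => key σ c w h' fun c' hc' _ => by rw [hne c' hc']
  -- `n` bounds the number of faces missing from the maximum |S| p; each melon removal, valid for
  -- both pairings, creates one for `τ`.
  induction n with
  | zero =>
    intro σ hn h h'
    by_cases hne : ∃ c ∈ S, σ c ≠ τ
    · obtain ⟨w, c, hc, hcw, hw⟩ := h.exists_melon hne
      obtain ⟨h1, -⟩ := melon_removal_counts (by omega) hc hw hcw
      have h2 := Finset.sum_le_card_nsmul S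
        (fun c' => comp {Function.update σ c (cutPair w (τ w) (σ c)) c', τ}) (Fintype.card W)
        fun c' _ => comp_pair_le _ _
      rw [smul_eq_mul] at h2
      omega
    · push Not at hne
      exact hbase σ h' hne
  | succ n ih =>
    intro σ hn h h'
    by_cases hne : ∃ c ∈ S, σ c ≠ τ
    · obtain ⟨w, c, hc, hcw, hw⟩ := h.exists_melon hne
      obtain ⟨h1, -⟩ := melon_removal_counts (by omega) hc hw hcw
      have hτ := key σ c w h' hw
      refine ih (σ := Function.update σ c (cutPair w (τ w) (σ c))) (by omega)
        ((isSaturated_update_iff (by omega) hc hw).2 h) ?_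
      rw [← hτ] at hw ⊢
      exact (isSaturated_update_iff (by omega) hc hw).2 h'
    · push Not at hne
      exact hbase σ h' hne

end Saturated

/-! ### Canonical pairings are the saturated ones. -/

section Canonical

variable {p : ℕ}

lemma isSaturated_of_isCanonicalPairing {C : Type} [DecidableEq C] {S : Finset C}
    (hS : 2 ≤ S.card) {σ : C → Equiv.Perm (Fin p)} {τ : Equiv.Perm (Fin p)}
    (h : IsCanonicalPairing S σ τ) : IsSaturated S σ τ := by
  induction h with
  | two_vertices σ τ h => exact isSaturated_of_forall_eq (Finset.card_pos.1 (by omega)) h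
  | remove_melon σ τ w c hc hw _ ih => exact (isSaturated_update_iff hS hc hw).1 ih

/-- Each removal creates a face and there are at most |S| p of them, so `n` bounds the number of
removals left. -/
lemma isCanonicalPairing_of_isSaturated {C : Type} [DecidableEq C] {S : Finset C}
    (hS : 2 ≤ S.card) {τ : Equiv.Perm (Fin p)} (n : ℕ) :
    ∀ {σ : C → Equiv.Perm (Fin p)}, S.card * p ≤ ∑ c ∈ S, comp {σ c, τ} + n →
      IsSaturated S σ τ → IsCanonicalPairing S σ τ := by
  induction n with
  | zero =>
    intro σ hn h
    refine .two_vertices _ _ fun c hc => ?_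
    by_contra hne
    obtain ⟨w, c, hc, hcw, hw⟩ := h.exists_melon ⟨c, hc, hne⟩
    obtain ⟨h1, -⟩ := melon_removal_counts hS hc hw hcw
    have h2 : ∑ c' ∈ S, comp {Function.update σ c (cutPair w (τ w) (σ c)) c', τ} ≤
        S.card * p := by
      refine (Finset.sum_le_card_nsmul _ _ (Fintype.card (Fin p)) fun c' _ =>
        comp_pair_le _ _).trans ?_
      simp
    omega
  | succ n ih =>
    intro σ hn h
    by_cases hne : ∃ c ∈ S, σ c ≠ τ
    · obtain ⟨w, c, hc, hcw, hw⟩ := h.exists_melon hne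
      obtain ⟨h1, -⟩ := melon_removal_counts hS hc hw hcw
      exact .remove_melon _ _ w c hc hw
        (ih (by change _ ≤ ∑ c' ∈ S, comp {Function.update σ c (cutPair w (τ w) (σ c)) c', τ} + n
                omega) ((isSaturated_update_iff hS hc hw).2 h))
    · push Not at hne
      exact .two_vertices _ _ hne

lemma isCanonicalPairing_iff_isSaturated {C : Type} [DecidableEq C] {S : Finset C}
    (hS : 2 ≤ S.card) {σ : C → Equiv.Perm (Fin p)} {τ : Equiv.Perm (Fin p)} :
    IsCanonicalPairing S σ τ ↔ IsSaturated S σ τ :=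
  ⟨isSaturated_of_isCanonicalPairing hS, isCanonicalPairing_of_isSaturated hS _ (Nat.le_add_left _ _)⟩

end Canonical

/-! ### Saturated pairings do not cross a cut with one line per color. -/

section Crossing

variable {W B : Type*} {C : Type*} [Fintype W]

/-- Flux balance: with `Q` pulled back along a matching, it compares what leaves a set of vertices
with what enters it. -/
lemma sum_filter_add_sum_filter {M : Type*} [AddCommMonoid M] (g : W → M) (P Q : W → Prop)
    [DecidablePred P] [DecidablePred Q] :
    ∑ x with Q x, g x + ∑ x with P x ∧ ¬ Q x, g x =
      ∑ x with P x, g x + ∑ x with ¬ P x ∧ Q x, g x := by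
  simp only [Finset.sum_filter, ← Finset.sum_add_distrib]
  refine Finset.sum_congr rfl fun x _ => ?_
  by_cases hP : P x <;> by_cases hQ : Q x <;> simp [hP, hQ]

/-- Consider a set of white vertices and a set of black vertices with exactly one line of each
color entering the set, and none leaving it. A function constant on the faces which vanishes on the
entering pairs of `τ` vanishes on the leaving ones. -/
lemma eq_zero_of_mem_faceSpace {e τ : W ≃ B} (P : W → Prop) (Q : B → Prop) {z : W}
    (hz : ∀ x, ¬ P x ∧ Q (e x) ↔ x = z) (hout : ∀ x, P x → Q (e x)) {f : W → ℚ}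
    (hf : f ∈ faceSpace e τ) (hin : ∀ x, ¬ P x → Q (τ x) → f x = 0) {x : W} (hx : P x)
    (hxτ : ¬ Q (τ x)) : f x = 0 := by
  classical
  have h1 := sum_filter_add_sum_filter (fun x => f x ^ 2) P (fun x => Q (τ x))
  have h2 := sum_filter_add_sum_filter (fun x => f x ^ 2) P (fun x => Q (e x))
  -- `f` is invariant under the permutation e⁻¹ τ, so the net flux of `f ^ 2` is the same along `e`
  -- and `τ`. The flux leaving along `τ` is then -f(z)², and a nonpositive sum of squares vanishes
  -- term by term.
  have h3 : ∑ x with Q (τ x), f x ^ 2 = ∑ x with Q (e x), f x ^ 2 := by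
    rw [Finset.sum_filter, Finset.sum_filter, ← Equiv.sum_comp (τ.trans e.symm)
      (fun x => if Q (e x) then f x ^ 2 else 0)]
    refine Finset.sum_congr rfl fun x _ => ?_
    simp only [Equiv.trans_apply, Equiv.apply_symm_apply]
    rw [mem_faceSpace.1 hf x]
  have h4 : ∑ x with P x ∧ ¬ Q (e x), f x ^ 2 = 0 := by
    rw [Finset.filter_false_of_mem]
    · simp
    · rintro x - ⟨h, h'⟩; exact h' (hout x h)
  have h5 : ∑ x with ¬ P x ∧ Q (e x), f x ^ 2 = f z ^ 2 := by
    rw [show (Finset.univ.filter fun x => ¬ P x ∧ Q (e x)) = {z} by ext x; simp [hz]]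
    simp
  have h6 : ∑ x with ¬ P x ∧ Q (τ x), f x ^ 2 = 0 := by
    refine Finset.sum_eq_zero fun x hx => ?_
    rw [Finset.mem_filter] at hx
    simp [hin x hx.2.1 hx.2.2]
  have h7 : f x ^ 2 ≤ ∑ x with P x ∧ ¬ Q (τ x), f x ^ 2 :=
    Finset.single_le_sum (f := fun x => f x ^ 2) (fun _ _ => sq_nonneg _)
      (by simp [hx, hxτ])
  have h8 : f x ^ 2 ≤ 0 := by
    have := sq_nonneg (f z)
    linarith
  exact pow_eq_zero_iff two_ne_zero |>.1 (le_antisymm h8 (sq_nonneg _))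

/-- If a set of vertices is separated from the others by one line of each color (at least three
of them), all entering it, then no pair of a saturated pairing leaves it. -/
lemma IsSaturated.not_crossing [Finite B] {S : Finset C} (hS : 3 ≤ S.card) {σ : C → W ≃ B}
    {τ : W ≃ B} (h : IsSaturated S σ τ) (P : W → Prop) (Q : B → Prop) (z : C → W)
    (hz : ∀ c ∈ S, ∀ x, ¬ P x ∧ Q (σ c x) ↔ x = z c) (hout : ∀ c ∈ S, ∀ x, P x → Q (σ c x))
    (x₀ : W) (hx₀ : P x₀) : Q (τ x₀) := by
  classical
  by_contra hx₀τ
  let U := Finset.univ.filter fun x => P x ∧ ¬ Q (τ x)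
  let Y := Finset.univ.filter fun x => ¬ P x ∧ Q (τ x)
  have hUpos : 0 < U.card := Finset.card_pos.2 ⟨x₀, by simp [U, hx₀, hx₀τ]⟩
  -- Entering minus leaving is the same for all matchings, and it is 1 for a color.
  have hYU : Y.card = U.card + 1 := by
    obtain ⟨c, hc⟩ := Finset.card_pos.1 (by omega : 0 < S.card)
    have h1 := sum_filter_add_sum_filter (fun _ : W => (1 : ℕ)) P (fun x => Q (τ x))
    have h2 := sum_filter_add_sum_filter (fun _ : W => (1 : ℕ)) P (fun x => Q (σ c x))
    have h3 : ∑ x with Q (τ x), 1 = ∑ x with Q (σ c x), 1 := by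
      rw [Finset.sum_filter, Finset.sum_filter, ← Equiv.sum_comp (τ.trans (σ c).symm)
        (fun x => if Q (σ c x) then 1 else 0)]
      simp
    have h4 : ∑ x with P x ∧ ¬ Q (σ c x), 1 = 0 := by
      rw [Finset.filter_false_of_mem]
      · simp
      · rintro x - ⟨h, h'⟩; exact h' (hout c hc x h)
    have h5 : ∑ x with ¬ P x ∧ Q (σ c x), 1 = 1 := by
      rw [show (Finset.univ.filter fun x => ¬ P x ∧ Q (σ c x)) = {z c} by ext x; simp [hz c hc]]
      simp
    have h6 : U.card = ∑ x with P x ∧ ¬ Q (τ x), 1 := Finset.card_eq_sum_ones _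
    have h7 : Y.card = ∑ x with ¬ P x ∧ Q (τ x), 1 := Finset.card_eq_sum_ones _
    omega
  let K := {x // x ∈ U ∪ Y}
  have hK : Fintype.card K = U.card + Y.card := by
    rw [Fintype.card_coe, Finset.card_union_of_disjoint]
    rw [Finset.disjoint_left]
    intro x hx hx'
    simp only [U, Y, Finset.mem_filter] at hx hx'
    exact hx'.2.1 hx.2.1
  let R : (W → ℚ) →ₗ[ℚ] (K → ℚ) := LinearMap.funLeft ℚ ℚ Subtype.val
  -- By `eq_zero_of_mem_faceSpace`, these restrictions to the crossing pairs are determined by the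
  -- entering values.
  let V : S → Submodule ℚ (K → ℚ) := fun c => (faceSpace (σ c) τ).map R
  have hV : ∀ c, finrank ℚ (V c) ≤ Y.card := by
    intro c
    let r : (K → ℚ) →ₗ[ℚ] (Y → ℚ) :=
      LinearMap.funLeft ℚ ℚ fun y => ⟨y.1, Finset.mem_union_right _ y.2⟩
    have := LinearMap.finrank_le_finrank_of_injective (f := r.domRestrict (V c)) (by
      rw [← LinearMap.ker_eq_bot, LinearMap.ker_eq_bot']
      rintro ⟨_, f, hf, rfl⟩ hr
      have hY : ∀ x, ¬ P x → Q (τ x) → f x = 0 := fun x h1 h2 =>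
        congrFun hr ⟨x, by simp [Y, h1, h2]⟩
      ext ⟨x, hx⟩
      change f x = 0
      rcases Finset.mem_union.1 hx with hx | hx
      · simp only [U, Finset.mem_filter] at hx
        exact eq_zero_of_mem_faceSpace P Q (hz c c.2) (hout c c.2) hf hY hx.2.1 hx.2.2
      · simp only [Y, Finset.mem_filter] at hx
        exact hY x hx.2.1 hx.2.2)
    simpa using this
  let Ψ : (K → ℚ) →ₗ[ℚ] (∀ c, (K → ℚ) ⧸ V c) := LinearMap.pi fun c => (V c).mkQ
  have hΨ : LinearMap.range Ψ = ⊤ := by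
    rw [LinearMap.range_eq_top]
    intro y
    choose q hq using fun c => Submodule.Quotient.mk_surjective (V c) (y c)
    obtain ⟨f, hf⟩ := h.exists_sub_mem fun c x =>
      if hc : c ∈ S then if hx : x ∈ U ∪ Y then q ⟨c, hc⟩ ⟨x, hx⟩ else 0 else 0
    refine ⟨R f, funext fun c => ?_⟩
    rw [← hq c]
    refine (Submodule.Quotient.eq _).2 ⟨_, hf c c.2, ?_⟩
    ext ⟨x, hx⟩
    simp only [R, LinearMap.funLeft_apply, Pi.sub_apply, Finset.coe_mem, dif_pos, hx]
  -- Constants are constant on all faces, so at least one dimension of the domain is lost.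
  have hker : 0 < finrank ℚ (LinearMap.ker Ψ) := by
    rw [finrank_pos_iff_exists_ne_zero]
    refine ⟨⟨fun _ => 1, ?_⟩, ?_⟩
    · rw [LinearMap.mem_ker]
      funext c
      exact (Submodule.Quotient.mk_eq_zero _).2 ⟨fun _ => 1, fun _ => rfl, rfl⟩
    · intro h0
      have := congrFun (congrArg Subtype.val h0)
        ⟨x₀, Finset.mem_union_left _ (by simp [U, hx₀, hx₀τ])⟩
      simp at this
  have h1 := LinearMap.finrank_range_add_finrank_ker Ψ
  rw [hΨ, finrank_top, finrank_pi_fintype, finrank_fintype_fun_eq_card, hK] at h1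
  have h2 : ∀ c : S, U.card ≤ finrank ℚ ((K → ℚ) ⧸ V c) := by
    intro c
    have := Submodule.finrank_quotient_add_finrank (V c)
    rw [finrank_fintype_fun_eq_card, hK] at this
    have := hV c
    omega
  -- The codomain has dimension at least 3 |U|, but at most |U| + |Y| - 1 = 2 |U|, which contradicts
  -- |U| > 0.
  have h3 := Finset.card_nsmul_le_sum Finset.univ _ _ fun c (_ : c ∈ Finset.univ) => h2 c
  rw [Finset.card_univ, Fintype.card_coe, smul_eq_mul] at h3
  have h4 : 3 * U.card ≤ S.card * U.card := Nat.mul_le_mul_right _ hS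
  omega

end Crossing

/-! ### Saturation under contraction and gluing. -/

section Glue

variable {W B W' B' : Type*} {C : Type*}

/-- The face bound is the sum of `card_add_comp_contract_le` and of the face bound of the contracted
graph, so it is sharp if and only if both are. -/
lemma isSaturated_contract_iff [Fintype W] [Finite B] [DecidableEq B] [DecidableEq W]
    {S : Finset C} (hS : S.Nonempty) (σ : C → W ≃ B) (τ : W ≃ B) {w : W} {b : B} (hb : τ w = b) :
    IsSaturated S σ τ ↔
      IsSaturated S (fun c => contract w b (σ c)) (contract w b τ) ∧
      (S.filter fun c => σ c w = b).card + comp ((fun c => contract w b (σ c)) '' S) + 1 =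
        S.card + comp (σ '' S) := by
  have h1 := card_add_comp_contract_le w b σ hS
  have h2 : ∑ c ∈ S, comp {σ c, τ} = (S.filter fun c => σ c w = b).card +
      ∑ c ∈ S, comp {contract w b (σ c), contract w b τ} := by
    rw [Finset.card_filter, ← Finset.sum_add_distrib]
    exact Finset.sum_congr rfl fun c _ => comp_pair_contract (σ c) τ hb
  have := Fintype.ofFinite B
  have h3 := sum_faces_le (fun c => contract w b (σ c)) (contract w b τ) S
  have h4 : Fintype.card W = Fintype.card {x // x ≠ w} + 1 := by
    rw [Fintype.card_subtype_compl, Fintype.card_subtype_eq]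
    have := Fintype.card_pos_iff.2 ⟨w⟩
    omega
  rw [IsSaturated, IsSaturated, h2, h4, Nat.mul_add, Nat.mul_one]
  omega

/-- A perfect matching of a disjoint union which respects the first part is a disjoint union. -/
lemma exists_eq_sumCongr [Fintype W] [Fintype B] [Fintype W'] [Fintype B'] (τ : W ⊕ W' ≃ B ⊕ B')
    (hc : Fintype.card W = Fintype.card B) (h : ∀ x, ∃ y, τ (Sum.inl x) = Sum.inl y) :
    ∃ (τ₁ : W ≃ B) (τ₂ : W' ≃ B'), τ = τ₁.sumCongr τ₂ := by
  choose f hf using h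
  have hfi : Function.Injective f := fun x y hxy => by
    have : τ (Sum.inl x) = τ (Sum.inl y) := by rw [hf, hf, hxy]
    simpa using this
  have hfb : Function.Bijective f := (Fintype.bijective_iff_injective_and_card f).2 ⟨hfi, hc⟩
  have h' : ∀ x, ∃ y, τ (Sum.inr x) = Sum.inr y := by
    intro x
    rcases hx : τ (Sum.inr x) with y | y
    · obtain ⟨z, rfl⟩ := hfb.2 y
      rw [← hf, τ.injective.eq_iff] at hx
      simp at hx
    · exact ⟨y, rfl⟩
  choose g hg using h'
  have hgi : Function.Injective g := fun x y hxy => by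
    have : τ (Sum.inr x) = τ (Sum.inr y) := by rw [hg, hg, hxy]
    simpa using this
  have hc' : Fintype.card W' = Fintype.card B' := by
    have := Fintype.card_congr τ
    rw [Fintype.card_sum, Fintype.card_sum] at this
    omega
  refine ⟨Equiv.ofBijective f hfb,
    Equiv.ofBijective g ((Fintype.bijective_iff_injective_and_card g).2 ⟨hgi, hc'⟩), ?_⟩
  ext (x | x)
  · simp [hf]
  · simp [hg]

variable [DecidableEq B] [DecidableEq B']

lemma comp_pair_contract_union [Fintype W] [Fintype B] [Finite W'] [Finite B'] (e τ : W ≃ B)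
    (e' τ' : W' ≃ B') (w : W) (b : B') :
    comp {contract (Sum.inl w) (Sum.inr b) (e.sumCongr e'),
      contract (Sum.inl w) (Sum.inr b) (τ.sumCongr τ')} + 1 = comp {e, τ} + comp {e', τ'} := by
  have := comp_contract_union (fun i : Bool => if i then e else τ)
    (fun i : Bool => if i then e' else τ') w b (S := Set.univ) ⟨true, trivial⟩
  have hp : (Set.univ : Set Bool) = {true, false} := by ext x; cases x <;> simp
  rw [hp, Set.image_pair, Set.image_pair, Set.image_pair] at this
  simpa [union] using this

/-- Faces of each color, components and white vertices all add up minus one, so the two face bounds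
add up to that of the glued graph. -/
lemma isSaturated_glue_iff [Fintype W] [Fintype B] [Fintype W'] [Fintype B'] [DecidableEq W]
    [DecidableEq W'] {S : Finset C} (hS : S.Nonempty) (σ : C → W ≃ B) (σ' : C → W' ≃ B')
    (w : W) (b : B') (τ : W ≃ B) (τ' : W' ≃ B') :
    IsSaturated S (fun c => contract (Sum.inl w) (Sum.inr b) (union σ σ' c))
      (contract (Sum.inl w) (Sum.inr b) (τ.sumCongr τ')) ↔
    IsSaturated S σ τ ∧ IsSaturated S σ' τ' := by
  have h1 := comp_contract_union σ σ' w b (S := (S : Set C)) hS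
  have h2 : ∑ c ∈ S, comp {contract (Sum.inl w) (Sum.inr b) (union σ σ' c),
      contract (Sum.inl w) (Sum.inr b) (τ.sumCongr τ')} + S.card =
      ∑ c ∈ S, comp {σ c, τ} + ∑ c ∈ S, comp {σ' c, τ'} := by
    rw [Finset.card_eq_sum_ones, ← Finset.sum_add_distrib, ← Finset.sum_add_distrib]
    exact Finset.sum_congr rfl fun c _ => comp_pair_contract_union (σ c) τ (σ' c) τ' w b
  have h3 : Fintype.card {x : W ⊕ W' // x ≠ Sum.inl w} + 1 =
      Fintype.card W + Fintype.card W' := by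
    rw [Fintype.card_subtype_compl, Fintype.card_subtype_eq, Fintype.card_sum]
    have := Fintype.card_pos_iff.2 ⟨w⟩
    omega
  have h4 := sum_faces_le σ τ S
  have h5 := sum_faces_le σ' τ' S
  have h6 := congrArg (S.card * ·) h3
  simp only [Nat.mul_add, Nat.mul_one] at h6
  rw [IsSaturated, IsSaturated, IsSaturated]
  omega

lemma exists_contract_eq [DecidableEq W] (w : W) (b : B) (τ : {x // x ≠ w} ≃ {y // y ≠ b}) :
    ∃ τ' : W ≃ B, τ' w = b ∧ contract w b τ' = τ := by
  refine ⟨(Equiv.optionSubtypeNe w).symm.trans (τ.optionCongr.trans (Equiv.optionSubtypeNe b)),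
    by simp, ?_⟩
  ext ⟨x, hx⟩
  rw [contract_apply_coe, cutPair_eq_self (by simp)]
  simp [hx]

/-- The pairings of a graph obtained by gluing two graphs, which are saturated on at least three
colors, come from pairings of the two graphs. -/
lemma exists_eq_contract_sumCongr [Fintype W] [Fintype B] [Fintype W'] [Fintype B']
    [DecidableEq W] [DecidableEq W'] {S : Finset C} (hS : 3 ≤ S.card) (σ : C → W ≃ B)
    (σ' : C → W' ≃ B') (w : W) (b : B')
    (τ : {x : W ⊕ W' // x ≠ Sum.inl w} ≃ {y : B ⊕ B' // y ≠ Sum.inr b})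
    (h : IsSaturated S (fun c => contract (Sum.inl w) (Sum.inr b) (union σ σ' c)) τ) :
    ∃ (τ₁ : W ≃ B) (τ₂ : W' ≃ B'), τ = contract (Sum.inl w) (Sum.inr b) (τ₁.sumCongr τ₂) := by
  obtain ⟨c₀, hc₀⟩ := Finset.card_pos.1 (by omega : 0 < S.card)
  have hcard : Fintype.card W = Fintype.card B := Fintype.card_congr (σ c₀)
  -- The first graph has lost the white vertex `w`, so one line of each color enters it, coming from
  -- the former neighbor of `b`.
  have hcross := h.not_crossing hS (fun x => x.1.isLeft = true) (fun y => y.1.isLeft = true)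
    (fun c => ⟨Sum.inr ((σ' c).symm b), by simp⟩) ?_ ?_
  · obtain ⟨τ', hτ', rfl⟩ := exists_contract_eq _ _ τ
    have hleft : ∀ x, x ≠ w → ∃ y, τ' (Sum.inl x) = Sum.inl y := by
      intro x hx
      have := hcross ⟨Sum.inl x, by simpa using hx⟩ rfl
      rw [contract_apply_coe, cutPair_eq_self hτ'] at this
      exact ⟨_, (Sum.inl_getLeft _ this).symm⟩
    -- Without `w`, the white vertices of the first graph miss one of its black vertices; this `β`
    -- is the partner to give back to `w`.
    obtain ⟨β, hβ⟩ : ∃ β, ∀ x, τ' (Sum.inl x) ≠ Sum.inl β := by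
      by_contra! hcon
      choose g hg using hcon
      have hgi : Function.Injective g := fun x y hxy => by
        have := (hg x).symm.trans ((congrArg (fun z => τ' (Sum.inl z)) hxy).trans (hg y))
        simpa using this
      obtain ⟨β, hβ⟩ := ((Fintype.bijective_iff_injective_and_card g).2 ⟨hgi, hcard.symm⟩).2 w
      have := hg β
      rw [hβ, hτ'] at this
      simp at this
    obtain ⟨τ₁, τ₂, h12⟩ := exists_eq_sumCongr (cutPair (Sum.inl w) (Sum.inl β) τ') hcard (by
      intro x
      by_cases hx : x = w
      · subst hx; exact ⟨β, cutPair_self _ _ _⟩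
      · obtain ⟨y, hy⟩ := hleft x hx
        refine ⟨y, ?_⟩
        rw [cutPair_apply, hτ', Equiv.swap_apply_of_ne_of_ne (hβ x) (by rw [hy]; simp), hy])
    refine ⟨τ₁, τ₂, ?_⟩
    rw [← h12]
    ext x
    rw [contract_apply_coe, contract_apply_coe, cutPair_eq_self hτ', cutPair_apply, cutPair_self,
      cutPair_apply, hτ', Equiv.swap_comm, Equiv.swap_apply_self]
  · rintro c - ⟨x | x, hx⟩
    · simp [contract_apply_coe, cutPair_apply, union, Equiv.swap_apply_def]
    · simp only [contract_apply_coe, cutPair_apply, union, Equiv.sumCongr_apply, Sum.map_inr,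
        Sum.map_inl, Equiv.swap_apply_def, Subtype.mk.injEq, Sum.inr.injEq, Equiv.eq_symm_apply]
      split_ifs with h1 h2 <;> simp_all
  · rintro c - ⟨x | x, hx⟩ hP
    · have hx' : σ c x ≠ σ c w := fun h' => hx (by rw [(σ c).injective h'])
      simp [contract_apply_coe, cutPair_apply, union, Equiv.swap_apply_def, hx']
    · simp at hP

end Glue

end ColoredGraph

namespace ColoredGraph

/-! ### Pairings saturated on all slices, and relevance. -/

section Good

variable {W B W' B' : Type*} {d L : ℕ} (s : Fin d → Fin L)

/-- The total number of components of a graph on all the slices. -/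
def kappa (σ : Fin d → W ≃ B) : ℕ := ∑ l, comp (σ '' (slice s l : Set (Fin d)))

lemma totalComponents_eq_kappa (G : ColoredGraph (Fin d)) :
    totalComponents s G = kappa s G.line := by
  simp [totalComponents, kappa, numComponents_eq_comp]

/-- The pairing `τ` is saturated on all the slices. -/
def IsGood [Fintype W] (σ : Fin d → W ≃ B) (τ : W ≃ B) : Prop :=
  ∀ l, IsSaturated (slice s l) σ τ

/-- Euler's formula: besides the faces with color 0, the slice has a single pair of colors, whose
faces are its components. -/
lemma isSaturated_iff_planar (G : ColoredGraph (Fin d)) {l : Fin L} (hl : (slice s l).card = 2)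
    (τ : Equiv.Perm (Fin G.p)) :
    IsSaturated (slice s l) G.line τ ↔
      IsPlanarContraction s G l τ ∧ PreservesComponents s G l τ := by
  classical
  have h1 : (G.addZero τ).numComponents (slice₀ s l : Set (Option (Fin d))) =
      comp (insert τ (G.line '' (slice s l))) := by
    rw [numComponents_eq_comp]
    congr 1
    ext e
    simp only [slice₀, Set.mem_image, Finset.mem_coe]
    constructor
    · rintro ⟨_ | c, hc, rfl⟩
      · exact .inl rfl
      · exact .inr ⟨c, Finset.some_mem_insertNone.1 hc, rfl⟩
    · rintro (h | ⟨c, hc, h⟩)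
      · exact ⟨none, by simp, h.symm⟩
      · exact ⟨some c, by simpa using hc, h⟩
  have h2 : (G.addZero τ).numFaces (slice₀ s l) =
      comp (G.line '' (slice s l)) + ∑ c ∈ slice s l, comp {G.line c, τ} := by
    have hins : slice₀ s l = insert none ((slice s l).map Function.Embedding.some) := by
      ext (_ | c) <;> simp [slice₀]
    have hself : Finset.powersetCard 2 ((slice s l).map Function.Embedding.some) =
        {(slice s l).map Function.Embedding.some} := by
      conv_lhs => rw [← hl, ← Finset.card_map Function.Embedding.some (s := slice s l)]
      exact Finset.powersetCard_self _
    rw [numFaces, hins, Finset.powersetCard_succ_insert (by simp), hself, Finset.powersetCard_one,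
      Finset.sum_union, Finset.sum_singleton]
    · congr 1
      · rw [numComponents_eq_comp, Finset.coe_map, Set.image_image]
        rfl
      · rw [Finset.sum_image, Finset.sum_map, Finset.sum_map]
        · refine Finset.sum_congr rfl fun c _ => ?_
          rw [numComponents_eq_comp]
          simp only [Function.Embedding.coeFn_mk, Function.Embedding.some_apply,
            Finset.coe_insert, Finset.coe_singleton, Set.image_pair]
          rw [Set.pair_comm]
          rfl
        · intro x hx y hy hxy
          simp only [Finset.coe_map, Set.mem_image, Finset.mem_coe] at hx hy
          obtain ⟨_, ⟨x, -, rfl⟩, rfl⟩ := hx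
          obtain ⟨_, ⟨y, -, rfl⟩, rfl⟩ := hy
          have hx : (some x) ∈ (insert none {some x} : Finset (Option (Fin d))) := by simp
          have hxy' : (insert none {some x} : Finset (Option (Fin d))) = insert none {some y} := hxy
          rw [hxy'] at hx
          simp only [Finset.mem_insert, Finset.mem_singleton, reduceCtorEq, false_or] at hx
          obtain rfl := Option.some.inj hx
          rfl
    · rw [Finset.disjoint_singleton_left]
      intro h
      obtain ⟨t, -, ht⟩ := Finset.mem_image.1 h
      have : (none : Option (Fin d)) ∈ (slice s l).map Function.Embedding.some := by
        rw [← ht]; simp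
      simp at this
  have h3 : PreservesComponents s G l τ ↔
      comp (insert τ (G.line '' (slice s l))) = comp (G.line '' (slice s l)) := by
    rw [PreservesComponents, h1, numComponents_eq_comp]
  have h4 : IsPlanarContraction s G l τ ↔
      2 * comp (insert τ (G.line '' (slice s l))) + G.p =
        comp (G.line '' (slice s l)) + ∑ c ∈ slice s l, comp {G.line c, τ} := by
    have hp : (G.addZero τ).p = G.p := rfl
    rw [IsPlanarContraction, genus, h1, h2, hp, div_eq_zero_iff, or_iff_left two_ne_zero,
      sub_eq_zero]
    exact_mod_cast Iff.rfl
  rw [h3, h4]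
  constructor
  · intro h
    have h5 := h.comp_insert
    rw [IsSaturated, hl, Fintype.card_fin] at h
    exact ⟨by omega, h5⟩
  · rintro ⟨h5, h6⟩
    rw [IsSaturated, hl, Fintype.card_fin]
    omega

variable {s}

lemma isRelevant_iff (h_two : ∀ l, 2 ≤ (slice s l).card) (G : ColoredGraph (Fin d)) :
    IsRelevant s G ↔ ∃ τ, IsGood s G.line τ := by
  refine exists_congr fun τ => ⟨fun ⟨h3, h2⟩ l => ?_, fun h => ⟨fun l hl => ?_, fun l hl => ?_⟩⟩
  · rcases (h_two l).eq_or_lt with hl | hl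
    · exact (isSaturated_iff_planar s G hl.symm τ).2 (h2 l hl.symm)
    · exact (isCanonicalPairing_iff_isSaturated (h_two l)).1 (h3 l hl)
  · exact (isCanonicalPairing_iff_isSaturated (h_two l)).2 (h l)
  · exact (isSaturated_iff_planar s G hl τ).1 (h l)

lemma isSaturated_unique {C : Type*} [Fintype W] [Finite B] {S : Finset C} (hS : 3 ≤ S.card)
    {σ : C → W ≃ B} {τ τ' : W ≃ B} (h : IsSaturated S σ τ) (h' : IsSaturated S σ τ') : τ' = τ :=
  IsSaturated.unique hS _ (Nat.le_add_left _ _) h h'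

variable [DecidableEq B] [DecidableEq B']

lemma slice_nonempty (h_two : ∀ l, 2 ≤ (slice s l).card) (l : Fin L) : (slice s l).Nonempty :=
  Finset.card_pos.1 (by have := h_two l; omega)

lemma sum_card_slice_filter (P : Fin d → Prop) [DecidablePred P] :
    ∑ l, ((slice s l).filter P).card = (Finset.univ.filter P).card := by
  rw [Finset.card_eq_sum_card_fiberwise (f := s) (s := Finset.univ.filter P) (t := Finset.univ)
    (by simp)]
  refine Finset.sum_congr rfl fun l _ => ?_
  rw [slice, Finset.filter_comm]

lemma sum_card_slice : ∑ l, (slice s l).card = d := by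
  have := sum_card_slice_filter (s := s) (fun _ => True)
  simpa using this

/-- The number of lines between `w` and `b`. -/
def mult (σ : Fin d → W ≃ B) (w : W) (b : B) : ℕ := (Finset.univ.filter fun c => σ c w = b).card

/-- Summing the contraction bounds over the slices shows that no contraction term exceeds the
scaling of the graph. -/
lemma mult_add_kappa_contract_le [Finite W] [Finite B] (h_two : ∀ l, 2 ≤ (slice s l).card)
    (σ : Fin d → W ≃ B) (w : W) (b : B) :
    mult σ w b + kappa s (fun c => contract w b (σ c)) + L ≤ d + kappa s σ := by
  have h := Finset.sum_le_sum fun l (_ : l ∈ Finset.univ) =>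
    card_add_comp_contract_le w b σ (slice_nonempty h_two l)
  simp only [Finset.sum_add_distrib, sum_card_slice_filter, sum_card_slice] at h
  simpa [mult, kappa] using h

variable (s) in
/-- The contraction of `w` and `b` does not decrease the power of `N`. -/
def IsTight (σ : Fin d → W ≃ B) (w : W) (b : B) : Prop :=
  mult σ w b + kappa s (fun c => contract w b (σ c)) + L = d + kappa s σ

/-- Equality in a sum of inequalities forces equality on each slice. -/
lemma isTight_iff [Finite W] [Finite B] (h_two : ∀ l, 2 ≤ (slice s l).card)
    (σ : Fin d → W ≃ B) (w : W) (b : B) :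
    IsTight s σ w b ↔ ∀ l, ((slice s l).filter fun c => σ c w = b).card +
      comp ((fun c => contract w b (σ c)) '' (slice s l : Set (Fin d))) + 1 =
        (slice s l).card + comp (σ '' (slice s l : Set (Fin d))) := by
  have h := Finset.sum_eq_sum_iff_of_le fun l (_ : l ∈ Finset.univ) =>
    card_add_comp_contract_le w b σ (slice_nonempty h_two l)
  simp only [Finset.sum_add_distrib, sum_card_slice_filter, sum_card_slice, Finset.mem_univ,
    true_imp_iff] at h
  rw [← h, IsTight]
  simp [mult, kappa]

lemma isGood_contract_iff [Fintype W] [Finite B] [DecidableEq W]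
    (h_two : ∀ l, 2 ≤ (slice s l).card) (σ : Fin d → W ≃ B) {w : W} {b : B} {τ : W ≃ B}
    (hb : τ w = b) :
    IsGood s σ τ ↔ IsTight s σ w b ∧
      IsGood s (fun c => contract w b (σ c)) (contract w b τ) := by
  rw [isTight_iff h_two, and_comm, IsGood, IsGood, ← forall_and]
  exact forall_congr' fun l => isSaturated_contract_iff (slice_nonempty h_two l) σ τ hb

lemma kappa_glue [Fintype W] [Fintype B] [Finite W'] [Finite B']
    (h_two : ∀ l, 2 ≤ (slice s l).card) (σ : Fin d → W ≃ B) (σ' : Fin d → W' ≃ B') (w : W)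
    (b : B') :
    kappa s (fun c => contract (Sum.inl w) (Sum.inr b) (union σ σ' c)) + L =
      kappa s σ + kappa s σ' := by
  have h := Finset.sum_congr (s₁ := Finset.univ) rfl fun l _ =>
    comp_contract_union σ σ' w b (S := (slice s l : Set (Fin d))) (slice_nonempty h_two l)
  simpa [Finset.sum_add_distrib, kappa] using h

/-- One slice with three colors makes the pairing split, and the same splitting is then used on
every slice. -/
lemma exists_isGood_glue_iff [Fintype W] [Fintype B] [Fintype W'] [Fintype B'] [DecidableEq W]
    [DecidableEq W'] (h_two : ∀ l, 2 ≤ (slice s l).card) (h_three : ∃ l, 3 ≤ (slice s l).card)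
    (σ : Fin d → W ≃ B) (σ' : Fin d → W' ≃ B') (w : W) (b : B') :
    (∃ τ, IsGood s (fun c => contract (Sum.inl w) (Sum.inr b) (union σ σ' c)) τ) ↔
      (∃ τ, IsGood s σ τ) ∧ ∃ τ, IsGood s σ' τ := by
  constructor
  · rintro ⟨τ, hτ⟩
    obtain ⟨l₀, hl₀⟩ := h_three
    obtain ⟨τ₁, τ₂, rfl⟩ := exists_eq_contract_sumCongr hl₀ σ σ' w b τ (hτ l₀)
    have := fun l => (isSaturated_glue_iff (slice_nonempty h_two l) σ σ' w b τ₁ τ₂).1 (hτ l)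
    exact ⟨⟨τ₁, fun l => (this l).1⟩, ⟨τ₂, fun l => (this l).2⟩⟩
  · rintro ⟨⟨τ₁, h₁⟩, ⟨τ₂, h₂⟩⟩
    exact ⟨_, fun l => (isSaturated_glue_iff (slice_nonempty h_two l) σ σ' w b τ₁ τ₂).2
      ⟨h₁ l, h₂ l⟩⟩

open Classical in
/-- A white vertex of a graph with a good pairing has exactly one partner. -/
lemma sum_ite_isTight [Fintype W] [Fintype B] [DecidableEq W] (h_two : ∀ l, 2 ≤ (slice s l).card)
    (h_three : ∃ l, 3 ≤ (slice s l).card) (σ : Fin d → W ≃ B) (w : W) {R : Type*}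
    [AddCommMonoid R] (v : R) :
    ∑ b, (if IsTight s σ w b then
      if ∃ τ, IsGood s (fun c => contract w b (σ c)) τ then v else 0 else 0) =
      if ∃ τ, IsGood s σ τ then v else 0 := by
  have key : ∀ b, (IsTight s σ w b ∧ ∃ τ, IsGood s (fun c => contract w b (σ c)) τ) ↔
      ∃ τ, IsGood s σ τ ∧ τ w = b := by
    intro b
    constructor
    · rintro ⟨ht, τ, hτ⟩
      obtain ⟨τ', hb, rfl⟩ := exists_contract_eq w b τ
      exact ⟨τ', (isGood_contract_iff h_two σ hb).2 ⟨ht, hτ⟩, hb⟩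
    · rintro ⟨τ, hτ, hb⟩
      have := (isGood_contract_iff h_two σ hb).1 hτ
      exact ⟨this.1, _, this.2⟩
  simp_rw [← ite_and, key]
  split_ifs with h
  · obtain ⟨τ, hτ⟩ := h
    obtain ⟨l₀, hl₀⟩ := h_three
    rw [Finset.sum_eq_single (τ w), if_pos ⟨τ, hτ, rfl⟩]
    · intro b _ hb
      rw [if_neg]
      rintro ⟨τ', hτ', rfl⟩
      -- Uniqueness on a single slice with three colors excludes any other partner of `w`.
      exact hb (by rw [isSaturated_unique hl₀ (hτ l₀) (hτ' l₀)])
    · simp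
  · refine Finset.sum_eq_zero fun b _ => if_neg ?_
    rintro ⟨τ, hτ, -⟩
    exact h ⟨τ, hτ⟩

end Good

end ColoredGraph

namespace ColoredGraph

open MeasureTheory MvPolynomial

/-! ### Gaussian moments and integration by parts. -/

section Gaussian

/-- The moments of the Gaussian measure on `ℂ`. -/
def moment (α : ℝ) (m n : ℕ) : ℂ :=
  ∫ z : ℂ, z ^ m * starRingEnd ℂ z ^ n * (Real.exp (-(α * ‖z‖ ^ 2)) : ℂ)

lemma integral_norm_pow_mul_exp {α : ℝ} (hα : 0 < α) (q : ℕ) :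
    ∫ z : ℂ, ‖z‖ ^ q * Real.exp (-(α * ‖z‖ ^ 2)) =
      Real.pi * α ^ (-((q : ℝ) + 2) / 2) * Real.Gamma (((q : ℝ) + 2) / 2) := by
  have h := Complex.integral_rpow_mul_exp_neg_mul_rpow (p := 2) (q := q) (b := α) (by norm_num)
    (by have : (0 : ℝ) ≤ q := by positivity
        linarith) hα
  simp only [Real.rpow_natCast, Real.rpow_two] at h
  rw [mul_div_cancel_left₀ _ (two_ne_zero)] at h
  rw [← h]
  congr 1 with z
  rw [neg_mul]

/-- A non-integrable function has integral 0 by convention, whereas the closed formula is positive.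
-/
lemma integrable_norm_pow_mul_exp {α : ℝ} (hα : 0 < α) (q : ℕ) :
    Integrable fun z : ℂ => ‖z‖ ^ q * Real.exp (-(α * ‖z‖ ^ 2)) := by
  by_contra h
  have h1 := integral_norm_pow_mul_exp hα q
  rw [integral_undef h] at h1
  have : 0 < Real.pi * α ^ (-((q : ℝ) + 2) / 2) * Real.Gamma (((q : ℝ) + 2) / 2) := by
    have := Real.Gamma_pos_of_pos (s := ((q : ℝ) + 2) / 2) (by positivity)
    have := Real.pi_pos
    positivity
  exact this.ne h1

lemma integrable_moment {α : ℝ} (hα : 0 < α) (m n : ℕ) :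
    Integrable fun z : ℂ => z ^ m * starRingEnd ℂ z ^ n * (Real.exp (-(α * ‖z‖ ^ 2)) : ℂ) := by
  refine (integrable_norm_pow_mul_exp hα (m + n)).mono' ?_ (.of_forall fun z => ?_)
  · exact Continuous.aestronglyMeasurable (by fun_prop)
  · simp only [norm_mul, norm_pow, RCLike.norm_conj, Complex.norm_real, Real.norm_eq_abs,
      Real.abs_exp, pow_add]
    exact le_refl _

lemma moment_self {α : ℝ} (hα : 0 < α) (n : ℕ) :
    moment α n n = (Real.pi * α ^ (-((n : ℝ) + 1)) * n.factorial : ℝ) := by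
  have h := integral_norm_pow_mul_exp hα (2 * n)
  have e1 : (((2 * n : ℕ) : ℝ) + 2) / 2 = n + 1 := by push_cast; ring
  have e2 : -(((2 * n : ℕ) : ℝ) + 2) / 2 = -((n : ℝ) + 1) := by push_cast; ring
  rw [e1, e2, Real.Gamma_nat_eq_factorial] at h
  rw [← h, moment, ← integral_complex_ofReal]
  congr 1 with z
  rw [← mul_pow, Complex.mul_conj, Complex.normSq_eq_norm_sq]
  push_cast
  rw [pow_mul]

/-- The angle π / (m - n) of the rotation is chosen so that the integrand changes sign. -/
lemma moment_of_ne (α : ℝ) {m n : ℕ} (h : m ≠ n) : moment α m n = 0 := by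
  let u : Circle := Circle.exp (Real.pi / ((m : ℝ) - n))
  have hu : (u : ℂ) ^ m * starRingEnd ℂ (u : ℂ) ^ n = -1 := by
    have hmn : (m : ℂ) - n ≠ 0 := sub_ne_zero.2 (by exact_mod_cast h)
    have : starRingEnd ℂ (u : ℂ) = ((u⁻¹ : Circle) : ℂ) := (Circle.coe_inv_eq_conj u).symm
    rw [this, ← Circle.exp_neg, Circle.coe_exp, Circle.coe_exp, ← Complex.exp_nat_mul,
      ← Complex.exp_nat_mul, ← Complex.exp_add, ← Complex.exp_pi_mul_I]
    congr 1
    push_cast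
    field_simp
    ring
  have h1 : moment α m n = -moment α m n := by
    conv_lhs => rw [moment]
    rw [← (LinearIsometryEquiv.measurePreserving (rotation u)).integral_comp
      (rotation u).toHomeomorph.measurableEmbedding]
    rw [moment, ← integral_neg]
    congr 1 with z
    simp only [rotation_apply, norm_mul, Circle.norm_coe, one_mul, map_mul, mul_pow]
    linear_combination (z ^ m * starRingEnd ℂ z ^ n * (Real.exp (-(α * ‖z‖ ^ 2)) : ℂ)) * hu
  exact self_eq_neg.1 h1

/-- Integration by parts in one variable, read off the closed formula. For `n = 0` both sides
vanish, the truncated `n - 1` being multiplied by 0. -/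
lemma moment_succ {α : ℝ} (hα : 0 < α) (m n : ℕ) :
    moment α (m + 1) n = (α : ℂ)⁻¹ * (n * moment α m (n - 1)) := by
  rcases n with _ | n
  · simp [moment_of_ne α (Nat.succ_ne_zero m)]
  · by_cases h : m = n
    · subst h
      rw [Nat.add_sub_cancel, moment_self hα, moment_self hα]
      have : α ^ (-(((m + 1 : ℕ) : ℝ) + 1)) = α⁻¹ * α ^ (-((m : ℝ) + 1)) := by
        rw [← Real.rpow_neg_one α, ← Real.rpow_add hα]
        congr 1
        push_cast
        ring
      rw [this, Nat.factorial_succ]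
      push_cast
      ring
    · rw [moment_of_ne α (by omega), Nat.add_sub_cancel, moment_of_ne α h]
      simp

variable {I : Type*} [Fintype I]

/-- The evaluation of a polynomial in the variables `T` (left) and `T̄` (right). -/
def evalConj (T : I → ℂ) : MvPolynomial (I ⊕ I) ℂ →ₐ[ℂ] ℂ :=
  aeval (Sum.elim T fun a => starRingEnd ℂ (T a))

/-- The unnormalized Gaussian integral of a polynomial. -/
def gauss (α : ℝ) (P : MvPolynomial (I ⊕ I) ℂ) : ℂ :=
  ∫ T : I → ℂ, evalConj T P * (Real.exp (-(α * ∑ a, ‖T a‖ ^ 2)) : ℂ)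

lemma evalConj_monomial_mul_exp (α : ℝ) (k : I ⊕ I →₀ ℕ) (r : ℂ) (T : I → ℂ) :
    evalConj T (monomial k r) * (Real.exp (-(α * ∑ a, ‖T a‖ ^ 2)) : ℂ) =
      r * ∏ a, (T a ^ k (Sum.inl a) * starRingEnd ℂ (T a) ^ k (Sum.inr a) *
        (Real.exp (-(α * ‖T a‖ ^ 2)) : ℂ)) := by
  rw [evalConj, aeval_monomial, Finsupp.prod_fintype _ _ (by simp), Fintype.prod_sum_type,
    Finset.mul_sum, ← Finset.sum_neg_distrib, Real.exp_sum, Complex.ofReal_prod,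
    Finset.prod_mul_distrib, Finset.prod_mul_distrib]
  simp only [Sum.elim_inl, Sum.elim_inr, Algebra.algebraMap_self, RingHom.id_apply]
  ring

lemma integrable_gauss {α : ℝ} (hα : 0 < α) (P : MvPolynomial (I ⊕ I) ℂ) :
    Integrable fun T : I → ℂ => evalConj T P * (Real.exp (-(α * ∑ a, ‖T a‖ ^ 2)) : ℂ) := by
  induction P using MvPolynomial.induction_on' with
  | monomial k r =>
    simp_rw [evalConj_monomial_mul_exp]
    exact (Integrable.fintype_prod fun a =>
      integrable_moment hα (k (Sum.inl a)) (k (Sum.inr a))).const_mul r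
  | add P Q hP hQ =>
    simp_rw [map_add, add_mul]
    exact hP.add hQ

lemma gauss_monomial (α : ℝ) (k : I ⊕ I →₀ ℕ) (r : ℂ) :
    gauss α (monomial k r) = r * ∏ a, moment α (k (Sum.inl a)) (k (Sum.inr a)) := by
  simp_rw [gauss, evalConj_monomial_mul_exp]
  rw [integral_const_mul, integral_fintype_prod_volume_eq_prod (fun a (z : ℂ) =>
    z ^ k (Sum.inl a) * starRingEnd ℂ z ^ k (Sum.inr a) * (Real.exp (-(α * ‖z‖ ^ 2)) : ℂ))]
  rfl

lemma gauss_add {α : ℝ} (hα : 0 < α) (P Q : MvPolynomial (I ⊕ I) ℂ) :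
    gauss α (P + Q) = gauss α P + gauss α Q := by
  simp_rw [gauss, map_add, add_mul]
  exact integral_add (integrable_gauss hα P) (integrable_gauss hα Q)

lemma gauss_smul (α : ℝ) (r : ℂ) (P : MvPolynomial (I ⊕ I) ℂ) :
    gauss α (r • P) = r * gauss α P := by
  simp_rw [gauss, map_smul, smul_eq_mul, mul_assoc]
  exact integral_const_mul _ _

lemma gauss_one_ne_zero {α : ℝ} (hα : 0 < α) : gauss α (1 : MvPolynomial (I ⊕ I) ℂ) ≠ 0 := by
  have h : (1 : MvPolynomial (I ⊕ I) ℂ) = monomial 0 1 := rfl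
  rw [h, gauss_monomial, one_mul, Finset.prod_ne_zero_iff]
  intro a _
  simp only [Finsupp.coe_zero, Pi.zero_apply]
  rw [moment_self hα]
  have := Real.pi_pos
  exact_mod_cast (by positivity : 0 < Real.pi * α ^ (-(((0 : ℕ) : ℝ) + 1)) *
    ((Nat.factorial 0 : ℕ) : ℝ)).ne'

/-- Integration by parts. -/
lemma gauss_X_mul {α : ℝ} (hα : 0 < α) (a : I) (P : MvPolynomial (I ⊕ I) ℂ) :
    gauss α (X (Sum.inl a) * P) = (α : ℂ)⁻¹ * gauss α (pderiv (Sum.inr a) P) := by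
  classical
  induction P using MvPolynomial.induction_on' with
  | monomial k r =>
    obtain ⟨k', hk'⟩ : ∃ k' : I ⊕ I →₀ ℕ, k' = k - Finsupp.single (Sum.inr a) 1 := ⟨_, rfl⟩
    rw [X, monomial_mul, one_mul, pderiv_monomial, ← hk', gauss_monomial, gauss_monomial,
      ← Finset.mul_prod_erase _ _ (Finset.mem_univ a), ← Finset.mul_prod_erase _
        (fun x => moment α (k' (Sum.inl x)) (k' (Sum.inr x))) (Finset.mem_univ a)]
    have h : ∀ x ∈ Finset.univ.erase a,
        moment α ((Finsupp.single (Sum.inl a) 1 + k : I ⊕ I →₀ ℕ) (Sum.inl x))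
          ((Finsupp.single (Sum.inl a) 1 + k : I ⊕ I →₀ ℕ) (Sum.inr x)) =
        moment α (k' (Sum.inl x)) (k' (Sum.inr x)) := by
      intro x hx
      have hx' := Finset.ne_of_mem_erase hx
      simp [hk', hx'.symm]
    rw [Finset.prod_congr rfl h]
    simp only [hk', Finsupp.coe_add, Finsupp.coe_tsub, Pi.add_apply, Pi.sub_apply,
      Finsupp.single_eq_same, Finsupp.single_apply, reduceCtorEq, if_false, zero_add, tsub_zero]
    rw [add_comm 1, moment_succ hα]
    ring
  | add P Q hP hQ =>
    rw [mul_add, map_add, gauss_add hα, gauss_add hα, hP, hQ, mul_add]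

end Gaussian

end ColoredGraph

namespace ColoredGraph

open MvPolynomial

/-! ### Derivatives of the invariants as contractions of graphs. -/

section Polynomial

lemma derivation_prod {R A : Type*} [CommSemiring R] [CommSemiring A] [Algebra R A]
    (D : Derivation R A A) {J : Type*} [DecidableEq J] (t : Finset J) (f : J → A) :
    D (∏ j ∈ t, f j) = ∑ j ∈ t, (∏ k ∈ t.erase j, f k) * D (f j) := by
  induction t using Finset.induction_on with
  | empty => simp
  | insert j t hj ih =>
    rw [Finset.prod_insert hj, Derivation.leibniz, ih, Finset.sum_insert hj,
      Finset.erase_insert hj, smul_eq_mul, smul_eq_mul, add_comm, Finset.mul_sum]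
    congr 1
    refine Finset.sum_congr rfl fun k hk => ?_
    have hjk : j ≠ k := fun h => hj (h ▸ hk)
    rw [Finset.erase_insert_of_ne hjk, Finset.prod_insert (by simp [hj]), mul_assoc]

variable {W B W' B' : Type*} {d N : ℕ}

/-- The indices of the tensor at the black vertex `b`, when `a w` are the indices of the tensor at
the white vertex `w`. -/
def blackIndex (σ : Fin d → W ≃ B) (a : W → Fin d → Fin N) (b : B) : Fin d → Fin N :=
  fun c => a ((σ c).symm b) c

variable (N) in
/-- The invariant of a graph, as a polynomial in the tensor `T` (variables on the left) and `T̄`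
(variables on the right). -/
def poly [Fintype W] [DecidableEq W] [Fintype B] (σ : Fin d → W ≃ B) : MvPolynomial ((Fin d → Fin N) ⊕ (Fin d → Fin N)) ℂ :=
  ∑ a : W → Fin d → Fin N, (∏ w, X (Sum.inl (a w))) * ∏ b, X (Sum.inr (blackIndex σ a b))

lemma evalConj_poly (G : ColoredGraph (Fin d)) (T : (Fin d → Fin N) → ℂ) :
    evalConj T (poly N G.line) = G.invariant T := by
  simp only [poly, invariant, evalConj, map_sum, map_mul, map_prod, aeval_X, Sum.elim_inl,
    Sum.elim_inr]
  rfl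

lemma poly_of_isEmpty [Fintype W] [DecidableEq W] [Fintype B] [IsEmpty W] [IsEmpty B] (σ : Fin d → W ≃ B) : poly N σ = 1 := by
  simp [poly]

/-- The monomial of an index assignment, without the tensor at the white vertex `w`. -/
def restMonomial [Fintype W] [DecidableEq W] [Fintype B]
    (σ : Fin d → W ≃ B) (w : W) (a : W → Fin d → Fin N) :
    MvPolynomial ((Fin d → Fin N) ⊕ (Fin d → Fin N)) ℂ :=
  (∏ x ∈ Finset.univ.erase w, X (Sum.inl (a x))) * ∏ b, X (Sum.inr (blackIndex σ a b))

lemma poly_eq_sum_X_mul [Fintype W] [DecidableEq W] [Fintype B]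
    (σ : Fin d → W ≃ B) (w : W) :
    poly N σ = ∑ a : W → Fin d → Fin N, X (Sum.inl (a w)) * restMonomial σ w a := by
  refine Finset.sum_congr rfl fun a _ => ?_
  rw [restMonomial, ← mul_assoc, Finset.mul_prod_erase Finset.univ
    (fun x => (X (Sum.inl (a x)) : MvPolynomial ((Fin d → Fin N) ⊕ (Fin d → Fin N)) ℂ))
    (Finset.mem_univ w)]

/-- The sum over the index assignments for which the tensors at `w` and `b` are contracted. -/
def contractedSum [Fintype W] [DecidableEq W] [Fintype B] [DecidableEq B]
    (σ : Fin d → W ≃ B) (w : W) (b : B) :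
    MvPolynomial ((Fin d → Fin N) ⊕ (Fin d → Fin N)) ℂ :=
  ∑ a : W → Fin d → Fin N, if blackIndex σ a b = a w then
    (∏ x ∈ Finset.univ.erase w, X (Sum.inl (a x))) *
      ∏ y ∈ Finset.univ.erase b, X (Sum.inr (blackIndex σ a y)) else 0

lemma pderiv_whites (x : Fin d → Fin N) (t : Finset W) (a : W → Fin d → Fin N) :
    pderiv (Sum.inr x) (∏ w ∈ t, (X (Sum.inl (a w)) :
      MvPolynomial ((Fin d → Fin N) ⊕ (Fin d → Fin N)) ℂ)) = 0 := by
  classical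
  rw [derivation_prod]
  exact Finset.sum_eq_zero fun w _ => by rw [pderiv_X_of_ne (by simp), mul_zero]

lemma pderiv_blacks [Fintype B] [DecidableEq B] (σ : Fin d → W ≃ B) (x : Fin d → Fin N) (a : W → Fin d → Fin N) :
    pderiv (Sum.inr x) (∏ b, (X (Sum.inr (blackIndex σ a b)) :
      MvPolynomial ((Fin d → Fin N) ⊕ (Fin d → Fin N)) ℂ)) =
    ∑ b, if blackIndex σ a b = x then
      ∏ y ∈ Finset.univ.erase b, X (Sum.inr (blackIndex σ a y)) else 0 := by
  rw [derivation_prod]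
  refine Finset.sum_congr rfl fun b _ => ?_
  split_ifs with h
  · rw [h, pderiv_X_self, mul_one]
  · rw [pderiv_X_of_ne (by simpa using h), mul_zero]

lemma sum_pderiv_restMonomial [Fintype W] [DecidableEq W] [Fintype B] [DecidableEq B]
    (σ : Fin d → W ≃ B) (w : W) :
    ∑ a : W → Fin d → Fin N, pderiv (Sum.inr (a w)) (restMonomial σ w a) =
      ∑ b, contractedSum σ w b := by
  simp only [contractedSum]
  rw [Finset.sum_comm]
  refine Finset.sum_congr rfl fun a _ => ?_
  rw [restMonomial, pderiv_mul, pderiv_whites, zero_mul, zero_add, pderiv_blacks, Finset.mul_sum]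
  exact Finset.sum_congr rfl fun b _ => by rw [mul_ite, mul_zero]

/-- Differentiating another bubble contracts `w` with each of its black vertices, that is, inside
the disjoint union. -/
lemma sum_restMonomial_mul_pderiv [Fintype W] [DecidableEq W] [Fintype B] [DecidableEq B]
    [Fintype W'] [DecidableEq W'] [Fintype B'] [DecidableEq B'] (σ : Fin d → W ≃ B) (σ' : Fin d → W' ≃ B') (w : W) :
    ∑ a : W → Fin d → Fin N, restMonomial σ w a * pderiv (Sum.inr (a w)) (poly N σ') =
      ∑ b, contractedSum (union σ σ') (Sum.inl w) (Sum.inr b) := by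
  simp only [contractedSum]
  rw [Finset.sum_comm, ← (Equiv.sumArrowEquivProdArrow W W' (Fin d → Fin N)).symm.sum_comp,
    Fintype.sum_prod_type]
  refine Finset.sum_congr rfl fun a _ => ?_
  rw [poly, map_sum, Finset.mul_sum]
  refine Finset.sum_congr rfl fun a' _ => ?_
  rw [pderiv_mul, pderiv_whites, zero_mul, zero_add, pderiv_blacks, Finset.mul_sum,
    Finset.mul_sum]
  refine Finset.sum_congr rfl fun b _ => ?_
  have h1 : (Finset.univ.erase (Sum.inl w) : Finset (W ⊕ W')) =
      (Finset.univ.erase w).disjSum Finset.univ := by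
    ext (x | x) <;> simp
  have h2 : (Finset.univ.erase (Sum.inr b) : Finset (B ⊕ B')) =
      Finset.univ.disjSum (Finset.univ.erase b) := by
    ext (x | x) <;> simp
  have h3 : ∀ y, blackIndex (union σ σ')
      ((Equiv.sumArrowEquivProdArrow W W' (Fin d → Fin N)).symm (a, a')) (Sum.inl y) =
      blackIndex σ a y := fun y => rfl
  have h4 : ∀ y, blackIndex (union σ σ')
      ((Equiv.sumArrowEquivProdArrow W W' (Fin d → Fin N)).symm (a, a')) (Sum.inr y) =
      blackIndex σ' a' y := fun y => rfl
  rw [h1, h2, Finset.prod_disjSum, Finset.prod_disjSum, restMonomial]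
  simp only [h3, h4, Equiv.sumArrowEquivProdArrow_symm_apply_inl,
    Equiv.sumArrowEquivProdArrow_symm_apply_inr]
  rw [mul_ite, mul_zero, mul_ite, mul_zero]
  refine if_congr Iff.rfl ?_ rfl
  ring

lemma apply_symm_cutPair [DecidableEq B] {β : Type*} (e : W ≃ B) {w : W} {b : B} {g : W → β}
    (h : g (e.symm b) = g w) (y : W) : g (e.symm (cutPair w b e y)) = g y := by
  rw [cutPair_apply, Equiv.swap_apply_def]
  split_ifs with h1 h2
  · rw [Equiv.symm_apply_apply, ← h, ← h1, Equiv.symm_apply_apply]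
  · rw [h, e.injective h2]
  · rw [Equiv.symm_apply_apply]

/-- A color joining `w` to `b` leaves the index at `w` free and gives a factor N; in any other color
it is fixed by the line arriving at `b`, which merges the two cut lines. -/
lemma contractedSum_eq [Fintype W] [DecidableEq W] [Fintype B] [DecidableEq B]
    (σ : Fin d → W ≃ B) (w : W) (b : B) :
    (contractedSum σ w b : MvPolynomial ((Fin d → Fin N) ⊕ (Fin d → Fin N)) ℂ) =
      ((N : ℂ) ^ mult σ w b) • poly N (fun c => contract w b (σ c)) := by
  rw [contractedSum, ← (Equiv.funSplitAt w (Fin d → Fin N)).symm.sum_comp,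
    Fintype.sum_prod_type_right, poly, Finset.smul_sum]
  refine Finset.sum_congr rfl fun a' _ => ?_
  set M : MvPolynomial ((Fin d → Fin N) ⊕ (Fin d → Fin N)) ℂ := (∏ x, X (Sum.inl (a' x))) * ∏ y, X (Sum.inr
    (blackIndex (fun c => contract w b (σ c)) a' y)) with hM
  have hsplit : ∀ (x : Fin d → Fin N) (y : W) (hy : y ≠ w),
      (Equiv.funSplitAt w (Fin d → Fin N)).symm (x, a') y = a' ⟨y, hy⟩ := by
    intro x y hy
    simp [Equiv.funSplitAt, Equiv.piSplitAt, hy]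
  have hw : ∀ x : Fin d → Fin N,
      (Equiv.funSplitAt w (Fin d → Fin N)).symm (x, a') w = x := by
    intro x
    simp [Equiv.funSplitAt, Equiv.piSplitAt]
  let A : Fin d → Finset (Fin N) := fun c =>
    if h : σ c w = b then Finset.univ else
      {a' ⟨(σ c).symm b, fun h' => h (by rw [← h', Equiv.apply_symm_apply])⟩ c}
  have hcond : ∀ x : Fin d → Fin N, blackIndex σ
      ((Equiv.funSplitAt w (Fin d → Fin N)).symm (x, a')) b =
      (Equiv.funSplitAt w (Fin d → Fin N)).symm (x, a') w ↔ x ∈ Fintype.piFinset A := by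
    intro x
    rw [funext_iff, Fintype.mem_piFinset]
    refine forall_congr' fun c => ?_
    rw [hw, blackIndex]
    by_cases h : σ c w = b
    · simp only [A, h, dif_pos, Finset.mem_univ, iff_true]
      rw [← h, Equiv.symm_apply_apply, hw]
    · have h' : (σ c).symm b ≠ w := fun h' => h (by rw [← h', Equiv.apply_symm_apply])
      rw [hsplit x _ h']
      simp only [A, h, dif_neg, not_false_iff, Finset.mem_singleton]
      exact eq_comm
  have hterm : ∀ x ∈ Fintype.piFinset A,
      (∏ y ∈ Finset.univ.erase w, X (Sum.inl
        ((Equiv.funSplitAt w (Fin d → Fin N)).symm (x, a') y))) *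
      ∏ y ∈ Finset.univ.erase b, X (Sum.inr (blackIndex σ
        ((Equiv.funSplitAt w (Fin d → Fin N)).symm (x, a')) y)) = M := by
    intro x hx
    have hx' := (hcond x).2 hx
    rw [hM, Finset.prod_subtype (Finset.univ.erase w) (p := fun y => y ≠ w) (by simp),
      Finset.prod_subtype (Finset.univ.erase b) (p := fun y => y ≠ b) (by simp)]
    congr 1
    · exact Finset.prod_congr rfl fun y _ => by rw [hsplit x y y.2]
    · refine Finset.prod_congr rfl fun y _ => ?_
      congr 2
      funext c
      obtain ⟨z, rfl⟩ := (contract w b (σ c)).surjective y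
      simp only [blackIndex, contract_apply_coe, Equiv.symm_apply_apply]
      rw [apply_symm_cutPair (σ c) (g := fun v =>
        (Equiv.funSplitAt w (Fin d → Fin N)).symm (x, a') v c) (congrFun hx' c), hsplit x _ z.2]
  have hcard : (Fintype.piFinset A).card = N ^ mult σ w b := by
    have : ∀ c, (A c).card = if σ c w = b then N else 1 := by
      intro c
      by_cases h : σ c w = b <;> simp [A, h]
    rw [Fintype.card_piFinset, Finset.prod_congr rfl fun c _ => this c, Finset.prod_ite]
    simp [mult]
  simp_rw [hcond]
  rw [← Finset.sum_filter, Finset.sum_congr (s₂ := Fintype.piFinset A) (by ext; simp) hterm,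
    Finset.sum_const, hcard, ← Nat.cast_smul_eq_nsmul ℂ]
  push_cast
  rfl

lemma mult_union [DecidableEq B] [DecidableEq B'] (σ : Fin d → W ≃ B) (σ' : Fin d → W' ≃ B') (w : W) (b : B') :
    mult (union σ σ') (Sum.inl w) (Sum.inr b) = 0 := by
  simp [mult, union]

/-- Euler's identity for the variables `T̄`. -/
lemma sum_X_mul_pderiv_poly [Fintype W] [DecidableEq W] [Fintype B] [DecidableEq B]
    (σ : Fin d → W ≃ B) :
    ∑ x, X (Sum.inr x) * pderiv (Sum.inr x) (poly N σ) = (Fintype.card B : ℂ) • poly N σ := by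
  rw [poly, Finset.smul_sum]
  simp_rw [map_sum, Finset.mul_sum]
  rw [Finset.sum_comm]
  refine Finset.sum_congr rfl fun a _ => ?_
  simp_rw [pderiv_mul, pderiv_whites, zero_mul, zero_add, pderiv_blacks, Finset.mul_sum]
  rw [Finset.sum_comm]
  have : ∀ b, ∑ x, (X (Sum.inr x) : MvPolynomial ((Fin d → Fin N) ⊕ (Fin d → Fin N)) ℂ) *
      ((∏ w, X (Sum.inl (a w))) * if blackIndex σ a b = x then
        ∏ y ∈ Finset.univ.erase b, X (Sum.inr (blackIndex σ a y)) else 0) =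
      (∏ w, X (Sum.inl (a w))) * ∏ b, X (Sum.inr (blackIndex σ a b)) := by
    intro b
    rw [Finset.sum_eq_single (blackIndex σ a b)]
    · rw [if_pos rfl, ← Finset.mul_prod_erase Finset.univ
        (fun b => (X (Sum.inr (blackIndex σ a b)) :
          MvPolynomial ((Fin d → Fin N) ⊕ (Fin d → Fin N)) ℂ)) (Finset.mem_univ b)]
      ring
    · intro x _ hx
      rw [if_neg (Ne.symm hx), mul_zero, mul_zero]
    · simp
  rw [Finset.sum_congr rfl fun b _ => this b, Finset.sum_const, Finset.card_univ,
    Nat.cast_smul_eq_nsmul]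

end Polynomial

end ColoredGraph

namespace ColoredGraph

/-! ### The power series solution of the covariance equation. -/

section FixedPoint

open MvPowerSeries

variable {ι : Type*}

/-- Two power series agree in degree less than `k`. -/
def AgreeBelow (k : ℕ) (φ ψ : MvPowerSeries ι ℂ) : Prop :=
  ∀ m : ι →₀ ℕ, m.degree < k → coeff m φ = coeff m ψ

lemma AgreeBelow.mul {k : ℕ} {φ ψ φ' ψ' : MvPowerSeries ι ℂ} (h : AgreeBelow k φ ψ)
    (h' : AgreeBelow k φ' ψ') : AgreeBelow k (φ * φ') (ψ * ψ') := by
  classical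
  intro m hm
  rw [coeff_mul, coeff_mul]
  refine Finset.sum_congr rfl fun x hx => ?_
  have hx' := congrArg Finsupp.degree (Finset.HasAntidiagonal.mem_antidiagonal.1 hx)
  rw [map_add] at hx'
  rw [h _ (by omega), h' _ (by omega)]

lemma AgreeBelow.pow {k : ℕ} {φ ψ : MvPowerSeries ι ℂ} (h : AgreeBelow k φ ψ) (n : ℕ) :
    AgreeBelow k (φ ^ n) (ψ ^ n) := by
  induction n with
  | zero => intro m _; simp
  | succ n ih => rw [pow_succ, pow_succ]; exact ih.mul h

lemma degree_tsub_single {m : ι →₀ ℕ} {i : ι} (h : 1 ≤ m i) :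
    (m - Finsupp.single i 1).degree + 1 = m.degree := by
  have h1 : m - Finsupp.single i 1 + Finsupp.single i 1 = m :=
    tsub_add_cancel_of_le (Finsupp.single_le_iff.2 h)
  have := congrArg Finsupp.degree h1
  rwa [map_add, Finsupp.degree_single] at this

open Classical in
lemma coeff_X_mul' (m : ι →₀ ℕ) (i : ι) (φ : MvPowerSeries ι ℂ) :
    coeff m (X i * φ) = if 1 ≤ m i then coeff (m - Finsupp.single i 1) φ else 0 := by
  rw [X, coeff_monomial_mul, one_mul]
  simp only [Finsupp.single_le_iff]

lemma AgreeBelow.X_mul {k : ℕ} {φ ψ : MvPowerSeries ι ℂ} (h : AgreeBelow k φ ψ) (i : ι) :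
    AgreeBelow (k + 1) (X i * φ) (X i * ψ) := by
  intro m hm
  rw [coeff_X_mul', coeff_X_mul']
  split_ifs with hi
  · have := degree_tsub_single hi
    exact h _ (by omega)
  · rfl

/-- The equation on the full covariance has a solution. -/
lemma exists_covariance (R : Finset ι) (p : ι → ℕ) :
    ∃ U : MvPowerSeries ι ℂ, U = 1 - ∑ i ∈ R, X i * C (p i : ℂ) * U ^ p i := by
  let Φ : MvPowerSeries ι ℂ → MvPowerSeries ι ℂ := fun U =>
    1 - ∑ i ∈ R, X i * C (p i : ℂ) * U ^ p i
  -- Every term carries a factor `X i`, so `Φ` is a contraction for the degree filtration.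
  have hΦ : ∀ k φ ψ, AgreeBelow k φ ψ → AgreeBelow (k + 1) (Φ φ) (Φ ψ) := by
    intro k φ ψ h m hm
    simp only [Φ, map_sub, map_sum]
    congr 1
    refine Finset.sum_congr rfl fun i _ => ?_
    rw [mul_assoc, mul_assoc]
    exact AgreeBelow.X_mul (AgreeBelow.mul (fun _ _ => rfl) (h.pow _)) i m hm
  let u : ℕ → MvPowerSeries ι ℂ := fun k => Φ^[k] 0
  have hu : ∀ k, u (k + 1) = Φ (u k) := fun k => Function.iterate_succ_apply' Φ k 0
  have h1 : ∀ k, AgreeBelow k (u k) (u (k + 1)) := by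
    intro k
    induction k with
    | zero => intro m hm; omega
    | succ k ih => rw [hu, hu (k + 1)]; exact hΦ k _ _ ih
  have h2 : ∀ k j, AgreeBelow k (u k) (u (k + j)) := by
    intro k j
    induction j with
    | zero => intro m _; rfl
    | succ j ih =>
      intro m hm
      rw [ih m hm]
      exact h1 (k + j) m (by omega)
  -- The coefficient at `m` is stationary from the iterate `m.degree + 1` on.
  let U : MvPowerSeries ι ℂ := fun m => coeff m (u (m.degree + 1))
  have hU : ∀ k, AgreeBelow k U (u k) := by
    intro k m hm
    obtain ⟨j, rfl⟩ := Nat.exists_eq_add_of_le (Nat.succ_le_of_lt hm)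
    exact h2 _ j m (Nat.lt_succ_self _)
  refine ⟨U, MvPowerSeries.ext fun m => ?_⟩
  change coeff m U = coeff m (Φ U)
  rw [hU (m.degree + 1) m (Nat.lt_succ_self _), hu]
  exact (hΦ m.degree _ _ (hU _) m (Nat.lt_succ_self _)).symm

end FixedPoint

/-! ### Perturbative expansion and Schwinger-Dyson equations. -/

section Series

open MvPolynomial

variable {d L : ℕ} (s : Fin d → Fin L) {ι : Type*} [Fintype ι] (Bs : ι → ColoredGraph (Fin d))
  (N : ℕ)

variable (d L) in
/-- The coefficient of the quadratic part of the action. -/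
def gaussWeight : ℝ := (N : ℝ) ^ ((d : ℤ) - L)

/-- The coefficient of a bubble in the action. -/
def bubbleWeight (i : ι) : ℂ :=
  (N : ℂ) ^ ((d : ℤ) - L) * (N : ℂ) ^ ((L : ℤ) - totalComponents s (Bs i))

/-- The term of order `m` in the expansion of the exponential of the interaction. -/
def interaction (m : ι →₀ ℕ) : MvPolynomial ((Fin d → Fin N) ⊕ (Fin d → Fin N)) ℂ :=
  ∏ i, C ((m i).factorial : ℂ)⁻¹ * (C (-bubbleWeight s Bs N i) * poly N (Bs i).line) ^ m i

/-- The perturbative expansion of the integral of a polynomial. -/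
def integralSeries (P : MvPolynomial ((Fin d → Fin N) ⊕ (Fin d → Fin N)) ℂ) :
    MvPowerSeries ι ℂ :=
  fun m => gauss (gaussWeight d L N) (P * interaction s Bs N m)

lemma coeff_integralSeries (P : MvPolynomial ((Fin d → Fin N) ⊕ (Fin d → Fin N)) ℂ)
    (m : ι →₀ ℕ) : MvPowerSeries.coeff m (integralSeries s Bs N P) =
      gauss (gaussWeight d L N) (P * interaction s Bs N m) := rfl

lemma formalIntegral_eq (P : MvPolynomial ((Fin d → Fin N) ⊕ (Fin d → Fin N)) ℂ) :
    formalIntegral s Bs N (fun T => evalConj T P) = integralSeries s Bs N P := by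
  ext m
  rw [coeff_integralSeries]
  change ∫ _, _ = ∫ _, _
  congr 1 with T
  congr 1
  rw [map_mul, interaction, map_prod]
  congr 1
  refine Finset.prod_congr rfl fun i _ => ?_
  rw [map_mul, map_pow, map_mul, evalConj_poly, ← algebraMap_eq, AlgHom.commutes,
    AlgHom.commutes, bubbleWeight, div_eq_inv_mul]
  simp only [Algebra.algebraMap_self, RingHom.id_apply]
  congr 2
  ring

variable {N}

lemma gaussWeight_pos (hN : 1 ≤ N) : 0 < gaussWeight d L N :=
  zpow_pos (by exact_mod_cast hN) _

lemma integralSeries_add (hN : 1 ≤ N)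
    (P Q : MvPolynomial ((Fin d → Fin N) ⊕ (Fin d → Fin N)) ℂ) :
    integralSeries s Bs N (P + Q) = integralSeries s Bs N P + integralSeries s Bs N Q := by
  ext m
  rw [map_add, coeff_integralSeries, coeff_integralSeries, coeff_integralSeries, add_mul,
    gauss_add (gaussWeight_pos hN)]

lemma integralSeries_smul (r : ℂ) (P : MvPolynomial ((Fin d → Fin N) ⊕ (Fin d → Fin N)) ℂ) :
    integralSeries s Bs N (r • P) = MvPowerSeries.C r * integralSeries s Bs N P := by
  ext m
  rw [MvPowerSeries.coeff_C_mul, coeff_integralSeries, coeff_integralSeries, smul_mul_assoc,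
    gauss_smul]

/-- As for an exponential, differentiation lowers one order by one, the factor `m i` canceling
against the factorial. -/
lemma pderiv_interaction (x : Fin d → Fin N) (m : ι →₀ ℕ) :
    pderiv (Sum.inr x) (interaction s Bs N m) =
      ∑ i, if 1 ≤ m i then (-bubbleWeight s Bs N i) • (pderiv (Sum.inr x) (poly N (Bs i).line) *
        interaction s Bs N (m - Finsupp.single i 1)) else 0 := by
  classical
  rw [interaction, derivation_prod]
  refine Finset.sum_congr rfl fun i _ => ?_
  rw [pderiv_C_mul, pderiv_pow, pderiv_C_mul]
  split_ifs with hi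
  · rw [interaction, ← Finset.mul_prod_erase Finset.univ _ (Finset.mem_univ i)]
    have h1 : ∀ j ∈ Finset.univ.erase i, (m - Finsupp.single i 1 : ι →₀ ℕ) j = m j := by
      intro j hj
      simp [(Finset.ne_of_mem_erase hj).symm]
    rw [Finset.prod_congr (g := fun j => C ((m j).factorial : ℂ)⁻¹ *
      (C (-bubbleWeight s Bs N j) * poly N (Bs j).line) ^ m j) (s₁ := Finset.univ.erase i)
      (f := fun j => C (((m - Finsupp.single i 1 : ι →₀ ℕ) j).factorial : ℂ)⁻¹ *
      (C (-bubbleWeight s Bs N j) * poly N (Bs j).line) ^ (m - Finsupp.single i 1 : ι →₀ ℕ) j)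
      rfl fun j hj => by rw [h1 j hj]]
    obtain ⟨k, hk⟩ : ∃ k, m i = k + 1 := ⟨m i - 1, by omega⟩
    have h2 : (m - Finsupp.single i 1 : ι →₀ ℕ) i = k := by simp [hk]
    rw [h2, hk, Nat.add_sub_cancel, Nat.factorial_succ, smul_eq_C_mul]
    have h3 : (C (((k + 1) * k.factorial : ℕ) : ℂ)⁻¹ * ((k + 1 : ℕ) : MvPolynomial _ ℂ) :
        MvPolynomial ((Fin d → Fin N) ⊕ (Fin d → Fin N)) ℂ) = C ((k.factorial : ℂ)⁻¹) := by
      rw [← map_natCast (C : ℂ →+* _), ← map_mul]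
      congr 1
      have := Nat.factorial_ne_zero k
      have : (k.factorial : ℂ) ≠ 0 := by exact_mod_cast this
      have : ((k : ℂ) + 1) ≠ 0 := by exact_mod_cast Nat.succ_ne_zero k
      push_cast
      field_simp
    rw [← h3]
    ring
  · have : m i = 0 := by omega
    simp [this]

/-- The Schwinger-Dyson equations. -/
lemma integralSeries_X_mul (hN : 1 ≤ N) (x : Fin d → Fin N)
    (P : MvPolynomial ((Fin d → Fin N) ⊕ (Fin d → Fin N)) ℂ) :
    integralSeries s Bs N (X (Sum.inl x) * P) =
      MvPowerSeries.C (gaussWeight d L N : ℂ)⁻¹ * (integralSeries s Bs N (pderiv (Sum.inr x) P) -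
        ∑ i, MvPowerSeries.X i * (MvPowerSeries.C (bubbleWeight s Bs N i) *
          integralSeries s Bs N (P * pderiv (Sum.inr x) (poly N (Bs i).line)))) := by
  classical
  have hα := gaussWeight_pos (d := d) (L := L) hN
  have h0 : gauss (gaussWeight d L N)
      (0 : MvPolynomial ((Fin d → Fin N) ⊕ (Fin d → Fin N)) ℂ) = 0 := by
    have := gauss_smul (gaussWeight d L N) 0
      (0 : MvPolynomial ((Fin d → Fin N) ⊕ (Fin d → Fin N)) ℂ)
    rwa [zero_smul, zero_mul] at this
  have hsum : ∀ (f : ι → MvPolynomial ((Fin d → Fin N) ⊕ (Fin d → Fin N)) ℂ),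
      gauss (gaussWeight d L N) (∑ i, f i) = ∑ i, gauss (gaussWeight d L N) (f i) := by
    intro f
    exact map_sum (⟨⟨gauss (gaussWeight d L N), h0⟩, gauss_add hα⟩ :
      MvPolynomial ((Fin d → Fin N) ⊕ (Fin d → Fin N)) ℂ →+ ℂ) f Finset.univ
  ext m
  rw [MvPowerSeries.coeff_C_mul, map_sub, map_sum, coeff_integralSeries, mul_assoc,
    gauss_X_mul hα, pderiv_mul, gauss_add hα, coeff_integralSeries, pderiv_interaction,
    Finset.mul_sum, hsum, sub_eq_add_neg, ← Finset.sum_neg_distrib]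
  congr 2
  refine Finset.sum_congr rfl fun i _ => ?_
  rw [coeff_X_mul']
  split_ifs with hi
  · rw [mul_smul_comm, gauss_smul, MvPowerSeries.coeff_C_mul, coeff_integralSeries, ← mul_assoc P]
    ring
  · rw [mul_zero, neg_zero, h0]

variable (N) in
/-- The expectation value of a polynomial. -/
def meanSeries (P : MvPolynomial ((Fin d → Fin N) ⊕ (Fin d → Fin N)) ℂ) : MvPowerSeries ι ℂ :=
  integralSeries s Bs N P * (integralSeries s Bs N 1)⁻¹

variable (N) in
lemma expectation_eq (A : ColoredGraph (Fin d)) :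
    expectation s Bs N A = meanSeries s Bs N (poly N A.line) := by
  rw [expectation, meanSeries, ← formalIntegral_eq, ← formalIntegral_eq]
  simp only [evalConj_poly, map_one]

lemma meanSeries_one (hN : 1 ≤ N) : meanSeries s Bs N 1 = 1 := by
  refine MvPowerSeries.mul_inv_cancel _ ?_
  rw [← MvPowerSeries.coeff_zero_eq_constantCoeff_apply, coeff_integralSeries]
  simpa [interaction] using gauss_one_ne_zero (gaussWeight_pos hN)

lemma meanSeries_smul (r : ℂ) (P : MvPolynomial ((Fin d → Fin N) ⊕ (Fin d → Fin N)) ℂ) :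
    meanSeries s Bs N (r • P) = MvPowerSeries.C r * meanSeries s Bs N P := by
  rw [meanSeries, meanSeries, integralSeries_smul, mul_assoc]

lemma meanSeries_sum (hN : 1 ≤ N) {J : Type*} (t : Finset J)
    (f : J → MvPolynomial ((Fin d → Fin N) ⊕ (Fin d → Fin N)) ℂ) :
    meanSeries s Bs N (∑ j ∈ t, f j) = ∑ j ∈ t, meanSeries s Bs N (f j) := by
  have h0 : meanSeries s Bs N 0 = 0 := by
    have := meanSeries_smul s Bs 0 (0 : MvPolynomial ((Fin d → Fin N) ⊕ (Fin d → Fin N)) ℂ)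
    rwa [zero_smul, map_zero, zero_mul] at this
  exact map_sum (⟨⟨meanSeries s Bs N, h0⟩, fun P Q => by
    simp only [meanSeries, integralSeries_add s Bs hN, add_mul]⟩ :
      MvPolynomial ((Fin d → Fin N) ⊕ (Fin d → Fin N)) ℂ →+ MvPowerSeries ι ℂ) f t

lemma meanSeries_X_mul (hN : 1 ≤ N) (x : Fin d → Fin N)
    (P : MvPolynomial ((Fin d → Fin N) ⊕ (Fin d → Fin N)) ℂ) :
    meanSeries s Bs N (X (Sum.inl x) * P) =
      MvPowerSeries.C (gaussWeight d L N : ℂ)⁻¹ * (meanSeries s Bs N (pderiv (Sum.inr x) P) -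
        ∑ i, MvPowerSeries.X i * (MvPowerSeries.C (bubbleWeight s Bs N i) *
          meanSeries s Bs N (P * pderiv (Sum.inr x) (poly N (Bs i).line)))) := by
  simp only [meanSeries]
  rw [integralSeries_X_mul s Bs hN, mul_assoc, sub_mul, Finset.sum_mul]
  simp only [mul_assoc]

lemma sum_meanSeries_X_mul (hN : 1 ≤ N) {J : Type*} [Fintype J] (x : J → Fin d → Fin N)
    (P : J → MvPolynomial ((Fin d → Fin N) ⊕ (Fin d → Fin N)) ℂ) :
    meanSeries s Bs N (∑ j, X (Sum.inl (x j)) * P j) =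
      MvPowerSeries.C (gaussWeight d L N : ℂ)⁻¹ *
        (meanSeries s Bs N (∑ j, pderiv (Sum.inr (x j)) (P j)) -
        ∑ i, MvPowerSeries.X i * (MvPowerSeries.C (bubbleWeight s Bs N i) *
          meanSeries s Bs N (∑ j, P j * pderiv (Sum.inr (x j)) (poly N (Bs i).line)))) := by
  rw [meanSeries_sum s Bs hN, meanSeries_sum s Bs hN]
  simp only [meanSeries_X_mul s Bs hN, meanSeries_sum s Bs hN, Finset.mul_sum]
  rw [← Finset.mul_sum, Finset.sum_sub_distrib, Finset.sum_comm]

/-- The Schwinger-Dyson equation at the white vertex `w` of a graph. -/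
lemma meanSeries_poly (hN : 1 ≤ N) {W B : Type*} [Fintype W] [DecidableEq W] [Fintype B]
    [DecidableEq B] (σ : Fin d → W ≃ B) (w : W) :
    meanSeries s Bs N (poly N σ) = MvPowerSeries.C (gaussWeight d L N : ℂ)⁻¹ *
      (∑ b, MvPowerSeries.C ((N : ℂ) ^ mult σ w b) *
          meanSeries s Bs N (poly N fun c => contract w b (σ c)) -
        ∑ i, MvPowerSeries.X i * (MvPowerSeries.C (bubbleWeight s Bs N i) *
          ∑ b, meanSeries s Bs N (poly N fun c =>
            contract (Sum.inl w) (Sum.inr b) (union σ (Bs i).line c)))) := by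
  rw [poly_eq_sum_X_mul σ w, sum_meanSeries_X_mul s Bs hN, sum_pderiv_restMonomial]
  simp only [sum_restMonomial_mul_pderiv, contractedSum_eq, mult_union, pow_zero, one_smul,
    meanSeries_sum s Bs hN, meanSeries_smul]

/-- The Schwinger-Dyson equation of the quadratic invariant. -/
lemma meanSeries_dipole (hN : 1 ≤ N) :
    meanSeries s Bs N (poly N (dipole (Fin d)).line) =
      MvPowerSeries.C (gaussWeight d L N : ℂ)⁻¹ * (MvPowerSeries.C ((N : ℂ) ^ d) -
        ∑ i, MvPowerSeries.X i * (MvPowerSeries.C (bubbleWeight s Bs N i * (Bs i).p) *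
          meanSeries s Bs N (poly N (Bs i).line))) := by
  -- Written as ∑ T_x T̄_x, the invariant lets Euler's identity turn the gluing terms into p_i times
  -- the bubbles themselves.
  have h1 : poly N (dipole (Fin d)).line =
      ∑ x : Fin d → Fin N, X (Sum.inl x) * X (Sum.inr x) := by
    refine Fintype.sum_equiv (Equiv.funUnique (Fin 1) (Fin d → Fin N)) _ _ fun x => ?_
    change (∏ w : Fin 1, _) * (∏ b : Fin 1, _) = _
    rw [Fin.prod_univ_one, Fin.prod_univ_one]
    rfl
  rw [h1, sum_meanSeries_X_mul s Bs hN]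
  simp only [pderiv_X_self, sum_X_mul_pderiv_poly, meanSeries_smul, Fintype.card_fin]
  congr 2
  · rw [meanSeries_sum s Bs hN, meanSeries_one s Bs hN]
    simp
  · simp only [map_mul, mul_assoc]

end Series

end ColoredGraph

namespace ColoredGraph

/-! ### The large N limit. -/

section Limit

variable {d L : ℕ} {s : Fin d → Fin L} {ι : Type*} [Fintype ι] {Bs : ι → ColoredGraph (Fin d)}

variable (s Bs) in
/-- The coefficients of the expectation value of a graph, rescaled. -/
def scaledCoeff {W B : Type*} [Fintype W] [DecidableEq W] [Fintype B] (σ : Fin d → W ≃ B)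
    (m : ι →₀ ℕ) (N : ℕ) : ℂ :=
  MvPowerSeries.coeff m (meanSeries s Bs N (poly N σ)) / (N : ℂ) ^ kappa s σ

/-- The scaling of the bubbles in the action is exactly what `kappa_glue` needs to cancel all powers
of N in the gluing terms. The natural subtraction in the exponent is exact by
`mult_add_kappa_contract_le`. -/
lemma scaledCoeff_eq (h_two : ∀ l, 2 ≤ (slice s l).card) {N : ℕ} (hN : 1 ≤ N) {W B : Type*}
    [Fintype W] [Fintype B] [DecidableEq W] [DecidableEq B] (σ : Fin d → W ≃ B) (w : W) (m : ι →₀ ℕ) :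
    scaledCoeff s Bs σ m N =
      ∑ b, ((N : ℂ) ^ (d + kappa s σ -
          (mult σ w b + kappa s (fun c => contract w b (σ c)) + L)))⁻¹ *
        scaledCoeff s Bs (fun c => contract w b (σ c)) m N -
      ∑ i, if 1 ≤ m i then ∑ b, scaledCoeff s Bs
        (fun c => contract (Sum.inl w) (Sum.inr b) (union σ (Bs i).line c))
        (m - Finsupp.single i 1) N else 0 := by
  have hN0 : (N : ℂ) ≠ 0 := by exact_mod_cast (by omega : N ≠ 0)
  have hα : (gaussWeight d L N : ℂ)⁻¹ = (N : ℂ) ^ L / (N : ℂ) ^ d := by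
    rw [gaussWeight]
    push_cast
    rw [zpow_sub₀ hN0, zpow_natCast, zpow_natCast, inv_div]
  have hβ : ∀ i, (gaussWeight d L N : ℂ)⁻¹ * bubbleWeight s Bs N i =
      (N : ℂ) ^ L / (N : ℂ) ^ kappa s (Bs i).line := by
    intro i
    have h : (gaussWeight d L N : ℂ) = (N : ℂ) ^ ((d : ℤ) - L) := by
      rw [gaussWeight]; push_cast; rfl
    rw [bubbleWeight, h, inv_mul_cancel_left₀ (zpow_ne_zero _ hN0), totalComponents_eq_kappa,
      zpow_sub₀ hN0, zpow_natCast, zpow_natCast]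
  rw [scaledCoeff, meanSeries_poly s Bs hN σ w, MvPowerSeries.coeff_C_mul, map_sub, map_sum,
    map_sum, mul_sub, sub_div, Finset.mul_sum, Finset.mul_sum, Finset.sum_div, Finset.sum_div]
  congr 1
  · refine Finset.sum_congr rfl fun b _ => ?_
    have hle := mult_add_kappa_contract_le h_two σ w b
    obtain ⟨e, he⟩ := Nat.exists_eq_add_of_le hle
    rw [MvPowerSeries.coeff_C_mul, scaledCoeff, he, Nat.add_sub_cancel_left, hα]
    have hp := congrArg (fun n => (N : ℂ) ^ n) he
    simp only [pow_add] at hp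
    field_simp
    linear_combination -(MvPowerSeries.coeff m
      (meanSeries s Bs N (poly N fun c => contract w b (σ c)))) * hp
  · refine Finset.sum_congr rfl fun i _ => ?_
    rw [coeff_X_mul']
    split_ifs with hi
    · rw [MvPowerSeries.coeff_C_mul, ← mul_assoc, hβ, map_sum, Finset.mul_sum, Finset.sum_div]
      refine Finset.sum_congr rfl fun b _ => ?_
      have hp := congrArg (fun n => (N : ℂ) ^ n) (kappa_glue h_two σ (Bs i).line w b)
      simp only [pow_add] at hp
      rw [scaledCoeff]
      field_simp
      linear_combination (MvPowerSeries.coeff (m - Finsupp.single i 1)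
        (meanSeries s Bs N (poly N fun c =>
          contract (Sum.inl w) (Sum.inr b) (union σ (Bs i).line c)))) * hp
    · simp

open Classical in
lemma tendsto_inv_pow_mul {f : ℕ → ℂ} {v : ℂ} (h : Tendsto f atTop (𝓝 v)) (e : ℕ) {P : Prop}
    (hP : P ↔ e = 0) :
    Tendsto (fun N : ℕ => ((N : ℂ) ^ e)⁻¹ * f N) atTop (𝓝 (if P then v else 0)) := by
  by_cases he : e = 0
  · rw [if_pos (hP.2 he)]
    simpa [he] using h
  · rw [if_neg (fun hp => he (hP.1 hp))]
    have h3 := (tendsto_inv_atTop_nhds_zero_nat (𝕜 := ℂ)).pow e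
    rw [zero_pow he] at h3
    simpa using h3.mul h

open Classical in
/-- The large `N` limit of the expectation value of a graph. -/
lemma tendsto_scaledCoeff (h_two : ∀ l, 2 ≤ (slice s l).card)
    (h_three : ∃ l, 3 ≤ (slice s l).card) {U : MvPowerSeries ι ℂ}
    (hU : U = 1 - ∑ i with ∃ τ, IsGood s (Bs i).line τ,
      MvPowerSeries.X i * MvPowerSeries.C ((Bs i).p : ℂ) * U ^ (Bs i).p) (k : ℕ) :
    ∀ (n : ℕ) (m : ι →₀ ℕ), m.degree = k → ∀ (W B : Type) [Fintype W] [Fintype B]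
      [DecidableEq W] [DecidableEq B] (σ : Fin d → W ≃ B), Fintype.card W = n → Fintype.card B = n →
      Tendsto (scaledCoeff s Bs σ m) atTop
        (𝓝 (if ∃ τ, IsGood s σ τ then MvPowerSeries.coeff m (U ^ n) else 0)) := by
  -- Contractions keep the degree and remove vertices; gluings may add vertices but lower the
  -- degree. The vertex types vary along the way, hence the quantification over `W` and `B`.
  induction k using Nat.strong_induction_on with
  | _ k ihk =>
  intro n
  induction n with
  | zero =>
    intro m hm W B _ _ _ _ σ hW hB
    have := Fintype.card_eq_zero_iff.1 hW
    have := Fintype.card_eq_zero_iff.1 hB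
    have hcomp : ∀ E : Set (W ≃ B), comp E = 0 := fun E =>
      Module.finrank_zero_of_subsingleton
    have hgood : ∃ τ, IsGood s σ τ :=
      ⟨Equiv.equivOfIsEmpty W B, fun l => by simp [IsSaturated, hcomp]⟩
    rw [if_pos hgood, pow_zero]
    refine tendsto_const_nhds.congr' ?_
    filter_upwards [eventually_ge_atTop 1] with N hN
    rw [scaledCoeff, poly_of_isEmpty, meanSeries_one s Bs hN]
    simp [kappa, hcomp]
  | succ n ihn =>
    intro m hm W B _ _ _ _ σ hW hB
    obtain ⟨w⟩ : Nonempty W := Fintype.card_pos_iff.1 (by omega)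
    have hev : (fun N : ℕ => ∑ b, ((N : ℂ) ^ (d + kappa s σ -
          (mult σ w b + kappa s (fun c => contract w b (σ c)) + L)))⁻¹ *
        scaledCoeff s Bs (fun c => contract w b (σ c)) m N -
      ∑ i, if 1 ≤ m i then ∑ b, scaledCoeff s Bs
        (fun c => contract (Sum.inl w) (Sum.inr b) (union σ (Bs i).line c))
        (m - Finsupp.single i 1) N else 0) =ᶠ[atTop] scaledCoeff s Bs σ m := by
      filter_upwards [eventually_ge_atTop 1] with N hN
      exact (scaledCoeff_eq h_two hN σ w m).symm
    refine Tendsto.congr' hev ?_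
    have hfirst : ∀ b, Tendsto (fun N : ℕ => ((N : ℂ) ^ (d + kappa s σ -
          (mult σ w b + kappa s (fun c => contract w b (σ c)) + L)))⁻¹ *
        scaledCoeff s Bs (fun c => contract w b (σ c)) m N) atTop
        (𝓝 (if IsTight s σ w b then
          if ∃ τ, IsGood s (fun c => contract w b (σ c)) τ then
            MvPowerSeries.coeff m (U ^ n) else 0 else 0)) := by
      intro b
      have h1 := ihn m hm {x // x ≠ w} {y // y ≠ b} (fun c => contract w b (σ c))
        (by rw [Fintype.card_subtype_compl, Fintype.card_subtype_eq, hW, Nat.add_sub_cancel])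
        (by rw [Fintype.card_subtype_compl, Fintype.card_subtype_eq, hB, Nat.add_sub_cancel])
      have hle := mult_add_kappa_contract_le h_two σ w b
      exact tendsto_inv_pow_mul h1 _ (by unfold IsTight; omega)
    have hsecond : ∀ i, Tendsto (fun N : ℕ => if 1 ≤ m i then ∑ b, scaledCoeff s Bs
        (fun c => contract (Sum.inl w) (Sum.inr b) (union σ (Bs i).line c))
        (m - Finsupp.single i 1) N else 0) atTop
        (𝓝 (if (∃ τ, IsGood s σ τ) ∧ ∃ τ, IsGood s (Bs i).line τ then
          MvPowerSeries.coeff m (MvPowerSeries.X i * (MvPowerSeries.C ((Bs i).p : ℂ) *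
            U ^ (n + (Bs i).p))) else 0)) := by
      intro i
      rw [coeff_X_mul']
      by_cases hi : 1 ≤ m i
      · simp only [if_pos hi]
        have hlt := degree_tsub_single hi
        have h1 : ∀ b, Tendsto (scaledCoeff s Bs
            (fun c => contract (Sum.inl w) (Sum.inr b) (union σ (Bs i).line c))
            (m - Finsupp.single i 1)) atTop
            (𝓝 (if (∃ τ, IsGood s σ τ) ∧ ∃ τ, IsGood s (Bs i).line τ then
              MvPowerSeries.coeff (m - Finsupp.single i 1) (U ^ (n + (Bs i).p)) else 0)) := by
          intro b
          have h2 := ihk (m - Finsupp.single i 1).degree (by omega) (n + (Bs i).p)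
            (m - Finsupp.single i 1) rfl {x : W ⊕ Fin (Bs i).p // x ≠ Sum.inl w}
            {y : B ⊕ Fin (Bs i).p // y ≠ Sum.inr b}
            (fun c => contract (Sum.inl w) (Sum.inr b) (union σ (Bs i).line c))
            (by rw [Fintype.card_subtype_compl, Fintype.card_subtype_eq, Fintype.card_sum, hW,
                  Fintype.card_fin]; omega)
            (by rw [Fintype.card_subtype_compl, Fintype.card_subtype_eq, Fintype.card_sum, hB,
                  Fintype.card_fin]; omega)
          simp only [exists_isGood_glue_iff h_two h_three σ (Bs i).line w b] at h2
          exact h2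
        have h3 := tendsto_finsetSum Finset.univ fun b (_ : b ∈ Finset.univ) => h1 b
        convert h3 using 2
        -- All black vertices of the bubble contribute equally, whence the factor p_i.
        rw [Finset.sum_const, Finset.card_univ, Fintype.card_fin, MvPowerSeries.coeff_C_mul]
        split_ifs <;> simp
      · simp only [if_neg hi, ite_self]
        exact tendsto_const_nhds
    have hlim := (tendsto_finsetSum Finset.univ fun b (_ : b ∈ Finset.univ) => hfirst b).sub
      (tendsto_finsetSum Finset.univ fun i (_ : i ∈ Finset.univ) => hsecond i)
    convert hlim using 2
    -- Among the contractions, only the one with the partner of `w` survives, if there is a good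
    -- pairing.
    rw [sum_ite_isTight h_two h_three σ w]
    by_cases hg : ∃ τ, IsGood s σ τ
    · simp only [hg, if_true, true_and]
      rw [← Finset.sum_filter]
      rw [← map_sum, ← map_sub]
      congr 1
      calc U ^ (n + 1) = U ^ n * (1 - ∑ i with ∃ τ, IsGood s (Bs i).line τ,
            MvPowerSeries.X i * MvPowerSeries.C ((Bs i).p : ℂ) * U ^ (Bs i).p) := by
              rw [← hU, pow_succ]
        _ = _ := by
          rw [mul_sub, mul_one, Finset.mul_sum]
          congr 1
          refine Finset.sum_congr rfl fun i _ => ?_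
          rw [pow_add]
          ring
    · simp [hg]

end Limit

section Dipole

variable {d L : ℕ} {s : Fin d → Fin L}

lemma comp_dipole {S : Finset (Fin d)} (hS : S.Nonempty) :
    comp ((dipole (Fin d)).line '' (S : Set (Fin d))) = 1 := by
  change comp ((fun _ => (1 : Equiv.Perm (Fin 1))) '' (S : Set (Fin d))) = 1
  rw [Set.Nonempty.image_const (Finset.coe_nonempty.2 hS), comp_singleton, Fintype.card_fin]

lemma kappa_dipole (h_two : ∀ l, 2 ≤ (slice s l).card) : kappa s (dipole (Fin d)).line = L := by
  rw [kappa, Finset.sum_congr rfl fun l _ => comp_dipole (slice_nonempty h_two l)]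
  simp

lemma isGood_dipole (h_two : ∀ l, 2 ≤ (slice s l).card) : IsGood s (dipole (Fin d)).line 1 :=
  fun l => isSaturated_of_forall_eq (slice_nonempty h_two l) fun _ _ => rfl

end Dipole

end ColoredGraph

end

open ColoredGraph in
theorem mainTheorem4 {d L : ℕ} (s : Fin d → Fin L)
    (h_two : ∀ l, 2 ≤ (slice s l).card) (h_three : ∃ l, 3 ≤ (slice s l).card)
    {ι : Type*} [Fintype ι] (B : ι → ColoredGraph (Fin d)) (hB : ∀ i, (B i).Connected) :
    -- the Schwinger-Dyson equation at finite `N`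
    (∀ N : ℕ, 1 ≤ N →
      MvPowerSeries.C ((N : ℂ) ^ d)
        - MvPowerSeries.C ((N : ℂ) ^ ((d : ℤ) - L)) *
            expectation s B N (ColoredGraph.dipole (Fin d))
        - ∑ i, MvPowerSeries.X i *
            (MvPowerSeries.C (((B i).p : ℂ) * (N : ℂ) ^ ((d : ℤ) - totalComponents s (B i))) *
              expectation s B N (B i)) = 0) ∧
    -- the large `N` limit
    ∃ U : MvPowerSeries ι ℂ,
      HasLeadingOrder s B (ColoredGraph.dipole (Fin d)) L U ∧
      (∀ A : ColoredGraph (Fin d), A.Connected →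
        (IsRelevant s A → HasLeadingOrder s B A (totalComponents s A) (U ^ A.p)) ∧
        (¬ IsRelevant s A → HasLeadingOrder s B A (totalComponents s A) 0) ∧
        -- non-melonic on a slice with at least three colors
        (∀ l, 3 ≤ (slice s l).card → ¬ IsMelonicOn s A l →
          HasLeadingOrder s B A (totalComponents s A) 0) ∧
        -- different canonical pairs on two slices with at least three colors
        (∀ l l' τ τ', 3 ≤ (slice s l).card → 3 ≤ (slice s l').card →
          IsCanonicalOn s A l τ → IsCanonicalOn s A l' τ' → τ ≠ τ' →
          HasLeadingOrder s B A (totalComponents s A) 0) ∧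
        -- the melonic contraction is non-planar, or merges components, on a slice with two colors
        (∀ l l' τ, 3 ≤ (slice s l).card → (slice s l').card = 2 → IsCanonicalOn s A l τ →
          ¬ (IsPlanarContraction s A l' τ ∧ PreservesComponents s A l' τ) →
          HasLeadingOrder s B A (totalComponents s A) 0)) ∧
      -- the equation on the full covariance
      (∀ R : Finset ι, (∀ i, i ∈ R ↔ IsRelevant s (B i)) →
        1 - U - ∑ i ∈ R, MvPowerSeries.X i * MvPowerSeries.C ((B i).p : ℂ) * U ^ (B i).p = 0) ∧
      ((∀ i, IsRelevant s (B i)) →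
        1 - U - ∑ i, MvPowerSeries.X i * MvPowerSeries.C ((B i).p : ℂ) * U ^ (B i).p = 0) := by
  classical
  -- Uniqueness identifies the pairing hidden in `IsRelevant` with any given canonical one, as the
  -- last two vanishing criteria require.
  have hcanon : ∀ (A : ColoredGraph (Fin d)) (l : Fin L), 3 ≤ (slice s l).card →
      ∀ τ τ', IsCanonicalOn s A l τ → IsCanonicalOn s A l τ' → τ' = τ := by
    intro A l hl τ τ' h h'
    exact isSaturated_unique hl
      (isSaturated_of_isCanonicalPairing (by omega) h)
      (isSaturated_of_isCanonicalPairing (by omega) h')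
  refine ⟨fun N hN => ?_, ?_⟩
  · have hN0 : (N : ℂ) ≠ 0 := by exact_mod_cast (by omega : N ≠ 0)
    have hα : ((gaussWeight d L N : ℝ) : ℂ) = (N : ℂ) ^ ((d : ℤ) - L) := by
      rw [gaussWeight]; push_cast; rfl
    have hb : ∀ i, bubbleWeight s B N i * (B i).p =
        ((B i).p : ℂ) * (N : ℂ) ^ ((d : ℤ) - totalComponents s (B i)) := by
      intro i
      rw [bubbleWeight, ← zpow_add₀ hN0, mul_comm]
      congr 2
      ring
    rw [expectation_eq, meanSeries_dipole s B hN, ← mul_assoc, ← map_mul, hα,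
      mul_inv_cancel₀ (zpow_ne_zero _ hN0), map_one, one_mul]
    simp only [hb, expectation_eq]
    rw [sub_sub_cancel, sub_self]
  · obtain ⟨U, hU⟩ := exists_covariance
      (Finset.univ.filter fun i => ∃ τ, IsGood s (B i).line τ) (fun i => (B i).p)
    have hlim : ∀ A : ColoredGraph (Fin d), HasLeadingOrder s B A (totalComponents s A)
        (if IsRelevant s A then U ^ A.p else 0) := by
      intro A m
      have h := tendsto_scaledCoeff (Bs := B) h_two h_three hU m.degree A.p m rfl (Fin A.p)
        (Fin A.p) A.line (Fintype.card_fin _) (Fintype.card_fin _)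
      rw [totalComponents_eq_kappa]
      simp only [expectation_eq, isRelevant_iff h_two]
      change Tendsto (scaledCoeff s B A.line m) atTop _
      convert h using 2
      split_ifs <;> simp
    have hzero : ∀ A : ColoredGraph (Fin d), ¬ IsRelevant s A →
        HasLeadingOrder s B A (totalComponents s A) 0 := by
      intro A hA
      have := hlim A
      rwa [if_neg hA] at this
    have hR : ∀ R : Finset ι, (∀ i, i ∈ R ↔ IsRelevant s (B i)) →
        1 - U - ∑ i ∈ R, MvPowerSeries.X i * MvPowerSeries.C ((B i).p : ℂ) * U ^ (B i).p = 0 := by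
      intro R hR
      have : R = Finset.univ.filter fun i => ∃ τ, IsGood s (B i).line τ := by
        ext i
        rw [hR, isRelevant_iff h_two]
        simp
      rw [this, sub_right_comm, ← hU, sub_self]
    refine ⟨U, ?_, fun A _ => ⟨fun hA => ?_, hzero A, fun l hl h => hzero A ?_,
      fun l l' τ τ' hl hl' h h' hne => hzero A ?_, fun l l' τ hl hl' h hn => hzero A ?_⟩, hR, ?_⟩
    · have h := hlim (dipole (Fin d))
      rw [if_pos ((isRelevant_iff h_two _).2 ⟨_, isGood_dipole h_two⟩), totalComponents_eq_kappa,
        kappa_dipole h_two] at h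
      have hp : U ^ (dipole (Fin d)).p = U := pow_one U
      rwa [hp] at h
    · have := hlim A
      rwa [if_pos hA] at this
    · rintro ⟨τ, h3, -⟩
      exact h ⟨τ, h3 l hl⟩
    · rintro ⟨τ₀, h3, -⟩
      exact hne ((hcanon A l hl _ _ (h3 l hl) h).trans (hcanon A l' hl' _ _ (h3 l' hl') h').symm)
    · rintro ⟨τ₀, h3, h2⟩
      rw [hcanon A l hl _ _ (h3 l hl) h] at hn
      exact hn (h2 l' hl')
    · intro hall
      exact hR Finset.univ fun i => by simp [hall i]
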